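/- **Setting.** Work on Minkowski space $\mathbb R\times\mathbb R^3$ with coordinates $x^0=t$, $\mathbf x=(x^1,x^2,x^3)$ and metric $g=\mathrm{diag}(-1,1,1,1)$; Greek indices run from $0$ to $3$, repeated indices are summed, $\partial_\nu=\partial/\partial x^\nu$. A perfect fluid is described by its number density $n\ge 0$, entropy per particle $s\ge 0$ and the spatial part $\mathbf u$ of its four-velocity $u=(u^0,\mathbf u)$, $u^0=\sqrt{1+|\mathbf u|^2}$. Its equation of state $\rho=\rho(n,s)\ge0$ (proper energy density) is of class $C^2$ on $\{n>0,\ s\ge 0\}$; the pressure is $p=n\,\partial\rho/\partial n-\rho$ (read as $p=-\rho$ at $n=0$), and it is assumed that $0\le p\le\rho$ for $n,s\ge0$ and that for $n>0$, $s\ge0$ $$\frac{\partial\rho}{\partial n}>0,\qquad \frac{\partial p}{\partial n}>0,\qquad \frac{\partial\rho}{\partial s}\ge 0\ \text{ with equality iff } s=0 .$$ The sound speed $\eta\ge0$ is given by $\eta^2=(dp/d\rho)_s=\frac{\partial p/\partial n}{\partial\rho/\partial n}$. Since $p$ is strictly increasing in $n$, for $n>0$ one may use $(p,s)$ as thermodynamic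 variables. The energy tensor is $T^{\mu\nu}=(\rho+p)u^\mu u^\nu+p\,g^{\mu\nu}$, and the equations of motion are $$\partial_\nu(nu^\nu)=0,\qquad (\rho+p)u^\nu\partial_\nu u^\mu+(g^{\mu\nu}+u^\mu u^\nu)\partial_\nu p=0,\qquad u^\nu\partial_\nu s=0. \tag{1}$$ A global-in-time $C^1$ solution is a triple $(n,s,\mathbf u)$ of class $C^1$ on $[0,\infty)\times\mathbb R^3$, with $n,s\ge0$, that satisfies (1) for $t>0$; at vacuum points $n=0$, if there are any, this includes that $\rho(n,s)$ and $p(n,s)$ are $C^1$ functions of $(t,\mathbf x)$ (where $n>0$ this is automatic). The initial data $(n_0,s_0,\mathbf u_0)$ at $t=0$ are smooth, $n_0,s_0\ge0$, and for some constants $R_0,\bar n,\bar s>0$ one has $n_0=\bar n$, $s_0=\bar s$, $\mathbf u_0=0$ for $|\mathbf x|>R_0$. Put $\bar\rho=\rho(\bar n,\bar s)$, $\bar\eta=\eta(\bar n,\bar s)$, and, evaluated on the data, $$E=\int_{\mathbb R^3}(T^{00}-\bar\rho)\,d\mathbf x,\qquad Q(0)=\int_{\mathbb R^3}\sum_{i=1}^3x^iT^{0i}\,d\mathbf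 x=\int_{\mathbb R^3}(\rho+p)\,u^0\,\mathbf x\cdot\mathbf u\,d\mathbf x .$$ **Theorem.** Assume that the equation of state satisfies * (A1) $\rho(p,s)$ is a non-increasing function of $s$ for each $p$; * (A2) $\eta(p,s)$ is a non-decreasing function of $p$ for each $s$; and that the initial data satisfy * (D1) $\bar\eta<\frac13$; * (D2) $E>0$; * (D3) $s_0(\mathbf x)\ge\bar s$ for all $|\mathbf x|\le R_0$; * (D4) $\displaystyle Q(0)>\frac{2\bar\eta}{1-3\bar\eta^2}\left(\int_{R_0}^\infty\frac{dr}{E\,r^2+\frac{4\pi}{3}\bar\rho\,r^5}\right)^{-1}.$ Then the Cauchy problem for (1) with these initial data has no global-in-time $C^1$ solution. -/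

import Mathlib

open scoped ContDiff

namespace RelFluid

noncomputable section

/-- Physical space `ℝ³` with the Euclidean norm. -/
abbrev Space : Type := EuclideanSpace ℝ (Fin 3)

/-- Minkowski spacetime in the global coordinates `(t, x)`. -/
abbrev Spacetime : Type := ℝ × Space

/-- The components `diag(-1, 1, 1, 1)` of the Minkowski metric; the inverse metric has the same
components. -/
def minkowski (μ ν : Fin 4) : ℝ :=
  if μ = ν then (if μ = 0 then -1 else 1) else 0

/-- The coordinate vector `∂_μ` of spacetime; index `0` is time, `1, 2, 3` are space. -/
def coordVec (μ : Fin 4) : Spacetime :=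
  (Fin.cons ((1 : ℝ), (0 : Space)) fun i : Fin 3 => ((0 : ℝ), EuclideanSpace.single i (1 : ℝ)) :
    Fin 4 → Spacetime) μ

/-- The partial derivative `∂_μ f` at the event `z`. -/
def partialD (μ : Fin 4) (f : Spacetime → ℝ) (z : Spacetime) : ℝ :=
  fderiv ℝ f z (coordVec μ)

/-- The four-velocity `(√(1 + |v|²), v)` with spatial part `v`. -/
def fourVel (v : Space) (μ : Fin 4) : ℝ :=
  (Fin.cons (Real.sqrt (1 + ‖v‖ ^ 2)) fun i : Fin 3 => v i : Fin 4 → ℝ) μ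

/-! ### Thermodynamics: `ρ n s` is the proper energy density as a function of the number density
`n` and the entropy per particle `s`. -/

/-- The pressure `p = n ∂ρ/∂n - ρ`. -/
def pressure (ρ : ℝ → ℝ → ℝ) (n s : ℝ) : ℝ :=
  n * deriv (fun m => ρ m s) n - ρ n s

/-- The sound speed: `η² = (dp/dρ)_s = (∂p/∂n) / (∂ρ/∂n)`. -/
def soundSpeed (ρ : ℝ → ℝ → ℝ) (n s : ℝ) : ℝ :=
  Real.sqrt (deriv (fun m => pressure ρ m s) n / deriv (fun m => ρ m s) n)

/-- The basic assumptions on the equation of state of a perfect fluid. The variables range over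
`n ≥ 0`, `s ≥ 0`; the conditions on derivatives concern `n > 0`. -/
structure IsEquationOfState (ρ : ℝ → ℝ → ℝ) : Prop where
  contDiffOn : ContDiffOn ℝ 2 (fun q : ℝ × ℝ => ρ q.1 q.2) (Set.Ioi 0 ×ˢ Set.Ici 0)
  rho_nonneg : ∀ n s, 0 ≤ n → 0 ≤ s → 0 ≤ ρ n s
  pressure_nonneg : ∀ n s, 0 ≤ n → 0 ≤ s → 0 ≤ pressure ρ n s
  pressure_le_rho : ∀ n s, 0 ≤ n → 0 ≤ s → pressure ρ n s ≤ ρ n s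
  deriv_rho_pos : ∀ n s, 0 < n → 0 ≤ s → 0 < deriv (fun m => ρ m s) n
  deriv_pressure_pos : ∀ n s, 0 < n → 0 ≤ s → 0 < deriv (fun m => pressure ρ m s) n
  deriv_entropy_nonneg : ∀ n s, 0 < n → 0 ≤ s → 0 ≤ derivWithin (fun σ => ρ n σ) (Set.Ici 0) s
  deriv_entropy_eq_zero_iff : ∀ n s, 0 < n → 0 ≤ s →
    (derivWithin (fun σ => ρ n σ) (Set.Ici 0) s = 0 ↔ s = 0)

/-- `ρ`, regarded as a function `ρ(p, s)` of pressure and entropy, is non-increasing in `s` for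
each `p`: two states with the same pressure are compared. (At fixed `s` the pressure is strictly
increasing in `n`, so `(p, s)` determines `n`.) -/
def RhoAntitoneInEntropy (ρ : ℝ → ℝ → ℝ) : Prop :=
  ∀ n₁ s₁ n₂ s₂ : ℝ, 0 < n₁ → 0 ≤ s₁ → 0 < n₂ → 0 ≤ s₂ →
    pressure ρ n₁ s₁ = pressure ρ n₂ s₂ → s₁ ≤ s₂ → ρ n₂ s₂ ≤ ρ n₁ s₁

/-- `η`, regarded as a function `η(p, s)` of pressure and entropy, is non-decreasing in `p` for
each `s`. -/
def SoundSpeedMonotoneInPressure (ρ : ℝ → ℝ → ℝ) : Prop :=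
  ∀ n₁ n₂ s : ℝ, 0 < n₁ → 0 < n₂ → 0 ≤ s →
    pressure ρ n₁ s ≤ pressure ρ n₂ s → soundSpeed ρ n₁ s ≤ soundSpeed ρ n₂ s

/-- The energy tensor `T^{μν} = (ρ + p) u^μ u^ν + p g^{μν}` of the state `(n, s, v)`. -/
def energyTensor (ρ : ℝ → ℝ → ℝ) (n s : ℝ) (v : Space) (μ ν : Fin 4) : ℝ :=
  (ρ n s + pressure ρ n s) * fourVel v μ * fourVel v ν + pressure ρ n s * minkowski μ ν

/-- `(n, s, u)` is a `C¹` solution on `[0, ∞) × ℝ³` of the relativistic perfect-fluid equations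
with data `(n₀, s₀, u₀)` at `t = 0`. The conditions `contDiff_rho` and `contDiff_pressure` follow
from the `C¹` regularity of `n` and `s` wherever `n > 0`; they matter only at vacuum points. -/
structure IsGlobalC1Solution (ρ : ℝ → ℝ → ℝ) (n₀ s₀ : Space → ℝ) (u₀ : Space → Space)
    (n s : Spacetime → ℝ) (u : Spacetime → Space) : Prop where
  contDiff_n : ContDiffOn ℝ 1 n (Set.Ici 0 ×ˢ Set.univ)
  contDiff_s : ContDiffOn ℝ 1 s (Set.Ici 0 ×ˢ Set.univ)
  contDiff_u : ContDiffOn ℝ 1 u (Set.Ici 0 ×ˢ Set.univ)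
  contDiff_rho : ContDiffOn ℝ 1 (fun z => ρ (n z) (s z)) (Set.Ici 0 ×ˢ Set.univ)
  contDiff_pressure : ContDiffOn ℝ 1 (fun z => pressure ρ (n z) (s z)) (Set.Ici 0 ×ˢ Set.univ)
  n_nonneg : ∀ z : Spacetime, 0 ≤ z.1 → 0 ≤ n z
  s_nonneg : ∀ z : Spacetime, 0 ≤ z.1 → 0 ≤ s z
  /-- `∂_ν (n u^ν) = 0`. -/
  continuity : ∀ z : Spacetime, 0 < z.1 →
    ∑ ν, partialD ν (fun y => n y * fourVel (u y) ν) z = 0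
  /-- `(ρ + p) u^ν ∂_ν u^μ + (g^{μν} + u^μ u^ν) ∂_ν p = 0`. -/
  momentum : ∀ z : Spacetime, 0 < z.1 → ∀ μ,
    (ρ (n z) (s z) + pressure ρ (n z) (s z)) *
        ∑ ν, fourVel (u z) ν * partialD ν (fun y => fourVel (u y) μ) z +
      ∑ ν, (minkowski μ ν + fourVel (u z) μ * fourVel (u z) ν) *
        partialD ν (fun y => pressure ρ (n y) (s y)) z = 0
  /-- `u^ν ∂_ν s = 0`. -/
  adiabatic : ∀ z : Spacetime, 0 < z.1 → ∑ ν, fourVel (u z) ν * partialD ν s z = 0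
  init_n : ∀ x, n (0, x) = n₀ x
  init_s : ∀ x, s (0, x) = s₀ x
  init_u : ∀ x, u (0, x) = u₀ x

/-- The data are smooth and coincide outside the ball of radius `R₀` with the quiet state of
number density `nbar` and entropy `sbar`. -/
structure IsQuietPerturbation (R₀ nbar sbar : ℝ) (n₀ s₀ : Space → ℝ) (u₀ : Space → Space) :
    Prop where
  R₀_pos : 0 < R₀
  nbar_pos : 0 < nbar
  sbar_pos : 0 < sbar
  contDiff_n₀ : ContDiff ℝ ∞ n₀
  contDiff_s₀ : ContDiff ℝ ∞ s₀
  contDiff_u₀ : ContDiff ℝ ∞ u₀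
  n₀_nonneg : ∀ x, 0 ≤ n₀ x
  s₀_nonneg : ∀ x, 0 ≤ s₀ x
  n₀_eq : ∀ x, R₀ < ‖x‖ → n₀ x = nbar
  s₀_eq : ∀ x, R₀ < ‖x‖ → s₀ x = sbar
  u₀_eq : ∀ x, R₀ < ‖x‖ → u₀ x = 0

/-- The total energy `∫ (T^{00} - T̄^{00}) dx` of the perturbation. -/
def perturbationEnergy (ρ : ℝ → ℝ → ℝ) (nbar sbar : ℝ) (n₀ s₀ : Space → ℝ)
    (u₀ : Space → Space) : ℝ :=
  ∫ x : Space, (energyTensor ρ (n₀ x) (s₀ x) (u₀ x) 0 0 - energyTensor ρ nbar sbar 0 0 0)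

/-- The total radial momentum `∫ ∑ᵢ xⁱ T^{0i} dx`. -/
def radialMomentum (ρ : ℝ → ℝ → ℝ) (n₀ s₀ : Space → ℝ) (u₀ : Space → Space) : ℝ :=
  ∫ x : Space, ∑ i : Fin 3, x i * energyTensor ρ (n₀ x) (s₀ x) (u₀ x) 0 i.succ

end

end RelFluid

namespace RelFluid

open MeasureTheory Set Filter Topology

noncomputable section

/-! The mechanism is a virial argument. Let Q(t) be the radial momentum of a global solution, K = ∫
(ρ+p)|u|², and let bars denote the quiet state. Three facts combine.

Propagation (`eq_quiet_of_lt_norm`): at time t the disturbance lies in the ball of radius r = R₀ +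
η̄t. Hence all integrals of perturbations are finite, E is conserved (`integral_energy`), and Q' = K
+ 3∫ (p - p̄) (`hasDerivAt_radialMomentum`).

Thermodynamics (`soundSpeed_sq_mul_rho_sub_le`): entropy is transported, so s ≥ s̄ persists, and
(A1), (A2) give p - p̄ ≥ η̄²(ρ - ρ̄). Since T⁰⁰ = ρ + (ρ+p)|u|², this yields Q' ≥ (1 - 3η̄²)K +
3η̄²E ≥ (1 - 3η̄²)K.

Cauchy–Schwarz (`radialMomentum_sq_le`): Q² ≤ K r² ∫ (ρ+p)(u⁰)² over the ball, and (ρ+p)(u⁰)² ≤ 2T⁰⁰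
because p ≤ ρ. So Q² ≤ 2K(Er² + (4π/3)ρ̄r⁵).

Together these form a Riccati inequality for Q. Integrating it over all times
(`integral_le_of_riccati`) bounds Q(0) from above, contrary to (D4).

The propagation step uses the conserved current J^ν = T^{0ν} - h̄nu^ν - p̄g^{0ν}, with h̄ = ∂ρ/∂n at
the quiet state. It is quadratically small there, and near it, on the isentrope s = s̄, its flux is
at most c J⁰ for each c > η̄. A weighted energy estimate in backward cones (`eq_quiet_of_timelike`),
continued in time (`eq_quiet_of_cone`), shows that the exterior stays quiet. -/

/-- The half-space `[0, ∞) × ℝ³` of spacetime. -/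
abbrev Future : Set Spacetime := Set.Ici 0 ×ˢ Set.univ

/-! ### Integrated balance laws for C¹ fields on the half-space. -/

lemma Future_mem_nhds {z : Spacetime} (hz : 0 < z.1) : Future ∈ 𝓝 z :=
  mem_of_superset
    ((isOpen_Ioi.prod isOpen_univ).mem_nhds (show z ∈ Ioi 0 ×ˢ univ from ⟨hz, trivial⟩))
    (prod_mono Ioi_subset_Ici_self subset_rfl)

lemma differentiableAt_of_future {F : Type*} [NormedAddCommGroup F] [NormedSpace ℝ F]
    {f : Spacetime → F} (hf : ContDiffOn ℝ 1 f Future) {z : Spacetime}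
    (hz : 0 < z.1) : DifferentiableAt ℝ f z :=
  (hf.contDiffAt (Future_mem_nhds hz)).differentiableAt one_ne_zero

lemma continuousOn_partialD {f : Spacetime → ℝ} (hf : ContDiffOn ℝ 1 f Future) (ν : Fin 4) :
    ContinuousOn (partialD ν f) (Ioi 0 ×ˢ univ) := by
  have h := (hf.mono (prod_mono Ioi_subset_Ici_self subset_rfl)).continuousOn_fderiv_of_isOpen
    (isOpen_Ioi.prod isOpen_univ) le_rfl
  exact h.clm_apply continuousOn_const

lemma continuous_slice {F : Type*} [TopologicalSpace F] {f : Spacetime → F}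
    (hf : ContinuousOn f Future) {t : ℝ} (ht : 0 ≤ t) :
    Continuous fun x : Space => f (t, x) :=
  hf.comp_continuous (by fun_prop) fun _ => ⟨ht, trivial⟩

lemma coordVec_zero : coordVec 0 = ((1 : ℝ), (0 : Space)) := rfl

lemma coordVec_succ (i : Fin 3) :
    coordVec i.succ = ((0 : ℝ), (EuclideanSpace.single i (1 : ℝ) : Space)) := rfl

/-- The divergence theorem without boundary term: integration by parts against the constant 1. -/
lemma integral_fderiv_eq_zero {f : Space → ℝ} (hf : Differentiable ℝ f) (v : Space)
    (hc : Continuous fun x => fderiv ℝ f x v) (hs : HasCompactSupport f) :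
    ∫ x, fderiv ℝ f x v = 0 := by
  have h1 : HasCompactSupport fun x => fderiv ℝ f x v := hs.fderiv_apply ℝ v
  have := integral_mul_fderiv_eq_neg_fderiv_mul_of_integrable (μ := volume)
    (f := fun _ : Space => (1 : ℝ)) (g := f) (v := v) (by simp) (by simpa using hc.integrable_of_hasCompactSupport h1)
    (by simpa using hf.continuous.integrable_of_hasCompactSupport hs) (fun x _ => by fun_prop)
    (fun x _ => hf x)
  simpa using this

lemma hasFDerivAt_slice {f : Spacetime → ℝ} (hf : ContDiffOn ℝ 1 f Future) {t : ℝ} (ht : 0 < t)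
    (x : Space) : HasFDerivAt (fun y : Space => f (t, y))
      ((fderiv ℝ f (t, x)).comp (ContinuousLinearMap.inr ℝ ℝ Space)) x :=
  (differentiableAt_of_future hf (z := (t, x)) ht).hasFDerivAt.comp x (hasFDerivAt_prodMk_right t x)

lemma hasDerivAt_time {f : Spacetime → ℝ} (hf : ContDiffOn ℝ 1 f Future) {t : ℝ} (ht : 0 < t)
    (x : Space) : HasDerivAt (fun τ => f (τ, x)) (partialD 0 f (t, x)) t := by
  have := ((differentiableAt_of_future hf (z := (t, x)) ht).hasFDerivAt.comp t
    (hasFDerivAt_prodMk_left t x)).hasDerivAt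
  simpa [partialD, coordVec_zero, Function.comp_def] using this

lemma partialD_eq_zero_of_support {f : Spacetime → ℝ} {T R : ℝ} {x₁ : Space}
    (hs : ∀ z : Spacetime, 0 ≤ z.1 → z.1 ≤ T → R < ‖z.2 - x₁‖ → f z = 0) (ν : Fin 4)
    {t : ℝ} (ht : t ∈ Ioo 0 T) {x : Space} (hx : R < ‖x - x₁‖) : partialD ν f (t, x) = 0 := by
  have : f =ᶠ[𝓝 (t, x)] fun _ => 0 := by
    have h1 : ∀ᶠ z : Spacetime in 𝓝 (t, x), z.1 ∈ Ioo 0 T :=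
      continuous_fst.continuousAt.eventually (isOpen_Ioo.mem_nhds ht)
    have h2 : ∀ᶠ z : Spacetime in 𝓝 (t, x), R < ‖z.2 - x₁‖ :=
      (by fun_prop : Continuous fun z : Spacetime => ‖z.2 - x₁‖).continuousAt.eventually
        (isOpen_Ioi.mem_nhds hx)
    filter_upwards [h1, h2] with z hz1 hz2 using hs z hz1.1.le hz1.2.le hz2
  simp [partialD, this.fderiv_eq]

lemma hasCompactSupport_of_norm_sub {f : Space → ℝ} {R : ℝ} {x₁ : Space}
    (hs : ∀ x, R < ‖x - x₁‖ → f x = 0) : HasCompactSupport f :=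
  HasCompactSupport.intro (isCompact_closedBall x₁ R) fun x hx => hs x (by
    simpa [dist_eq_norm] using hx)

/-- Continuity of the spatial integral of a density with spatially compact support. -/
lemma continuousOn_integral_slice {f : Spacetime → ℝ} (hf : ContinuousOn f Future) {T R : ℝ}
    {x₁ : Space} (hs : ∀ z : Spacetime, 0 ≤ z.1 → z.1 ≤ T → R < ‖z.2 - x₁‖ → f z = 0) :
    ContinuousOn (fun t => ∫ x, f (t, x)) (Icc 0 T) := by
  refine continuousOn_integral_of_compact_support (f := fun t x => f (t, x))
    (isCompact_closedBall x₁ R) ?_ ?_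
  · exact hf.mono (prod_mono (fun t ht => ht.1) subset_rfl)
  · intro t x ht hx
    exact hs (t, x) ht.1 ht.2 (by simpa [dist_eq_norm] using hx)

/-- The integrated balance law: the flux of a spatially compactly supported current does not
contribute. -/
lemma hasDerivAt_integral_slice {F : Fin 4 → Spacetime → ℝ} (hF : ∀ ν, ContDiffOn ℝ 1 (F ν) Future)
    {T R : ℝ} {x₁ : Space}
    (hs : ∀ ν, ∀ z : Spacetime, 0 ≤ z.1 → z.1 ≤ T → R < ‖z.2 - x₁‖ → F ν z = 0)
    {t : ℝ} (ht : t ∈ Ioo 0 T) :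
    HasDerivAt (fun t => ∫ x, F 0 (t, x)) (∫ x, ∑ ν, partialD ν (F ν) (t, x)) t := by
  have hcont : ∀ ν, Continuous fun x : Space => partialD ν (F ν) (t, x) := fun ν =>
    (continuousOn_partialD (hF ν) ν).comp_continuous (by fun_prop) fun _ => ⟨ht.1, trivial⟩
  have hint : ∀ ν, Integrable fun x : Space => partialD ν (F ν) (t, x) := fun ν =>
    (hcont ν).integrable_of_hasCompactSupport
      (hasCompactSupport_of_norm_sub fun x hx => partialD_eq_zero_of_support (hs ν) ν ht hx)
  have hspace : ∀ i : Fin 3, ∫ x, partialD i.succ (F i.succ) (t, x) = 0 := by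
    intro i
    have hfd := hasFDerivAt_slice (hF i.succ) ht.1
    have heq : (fun x => fderiv ℝ (fun y : Space => F i.succ (t, y)) x (EuclideanSpace.single i 1))
        = fun x => partialD i.succ (F i.succ) (t, x) := by
      ext x
      rw [(hfd x).fderiv]
      simp [partialD, coordVec_succ]
    have := integral_fderiv_eq_zero (f := fun y : Space => F i.succ (t, y))
      (fun x => (hfd x).differentiableAt) (EuclideanSpace.single i 1)
      (by rw [heq]; exact hcont _)
      (hasCompactSupport_of_norm_sub fun x hx => hs i.succ (t, x) ht.1.le ht.2.le hx)
    rwa [heq] at this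
  have hrhs : ∫ x, ∑ ν, partialD ν (F ν) (t, x) = ∫ x, partialD 0 (F 0) (t, x) := by
    rw [integral_finsetSum _ fun ν _ => hint ν, Fin.sum_univ_succ]
    simp [hspace]
  rw [hrhs]
  -- Derivatives are controlled only for positive times, so the dominating constant is taken on a
  -- compact time interval [a, b] inside (0, T).
  obtain ⟨a, ha0, hat⟩ := exists_between ht.1
  obtain ⟨b, htb, hbT⟩ := exists_between ht.2
  obtain ⟨C, hC⟩ := (isCompact_Icc.prod (isCompact_closedBall x₁ R)).exists_bound_of_continuousOn
    ((continuousOn_partialD (hF 0) 0).mono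
      (prod_mono (fun τ (hτ : τ ∈ Icc a b) => ha0.trans_le hτ.1) (subset_univ _)))
  refine (hasDerivAt_integral_of_dominated_loc_of_deriv_le (𝕜 := ℝ) (μ := volume)
    (F := fun t x => F 0 (t, x)) (F' := fun t x => partialD 0 (F 0) (t, x)) (x₀ := t)
    (s := Icc a b) (bound := (Metric.closedBall x₁ R).indicator fun _ => C)
    (Icc_mem_nhds hat htb) ?_ ?_ (hcont 0).aestronglyMeasurable ?_ ?_ ?_).2
  · filter_upwards [Ioi_mem_nhds ht.1] with τ hτ
    exact (continuous_slice (hF 0).continuousOn (le_of_lt hτ)).aestronglyMeasurable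
  · exact (continuous_slice (hF 0).continuousOn ht.1.le).integrable_of_hasCompactSupport
      (hasCompactSupport_of_norm_sub fun x hx => hs 0 (t, x) ht.1.le ht.2.le hx)
  · refine Eventually.of_forall fun x τ hτ => ?_
    by_cases hx : x ∈ Metric.closedBall x₁ R
    · rw [indicator_of_mem hx]
      exact hC (τ, x) ⟨hτ, hx⟩
    · rw [indicator_of_notMem hx, partialD_eq_zero_of_support (hs 0) 0
        ⟨ha0.trans_le hτ.1, hτ.2.trans_lt hbT⟩ (by simpa [dist_eq_norm] using hx)]
      simp
  · exact (integrable_indicator_iff measurableSet_closedBall).2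
      (integrableOn_const (isCompact_closedBall x₁ R).measure_lt_top.ne)
  · exact Eventually.of_forall fun x τ hτ => hasDerivAt_time (hF 0) (ha0.trans_le hτ.1) x

/-! ### The four-velocity and transport along it. -/

lemma fourVel_zero (v : Space) : fourVel v 0 = √(1 + ‖v‖ ^ 2) := rfl

lemma fourVel_succ (v : Space) (i : Fin 3) : fourVel v i.succ = v i := rfl

lemma one_le_fourVel_zero (v : Space) : 1 ≤ fourVel v 0 := by
  rw [fourVel_zero, Real.one_le_sqrt]
  nlinarith [sq_nonneg ‖v‖]

lemma fourVel_zero_sq (v : Space) : fourVel v 0 ^ 2 = 1 + ‖v‖ ^ 2 := by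
  rw [fourVel_zero, Real.sq_sqrt (by positivity)]

lemma norm_le_fourVel_zero (v : Space) : ‖v‖ ≤ fourVel v 0 := by
  rw [fourVel_zero]
  exact Real.le_sqrt_of_sq_le (by linarith)

lemma sum_single_eq (v : Space) :
    ∑ i : Fin 3, v i • (EuclideanSpace.single i (1 : ℝ) : Space) = v := by
  ext j
  fin_cases j <;> simp [Fin.sum_univ_three]

lemma sum_mul_partialD (f : Spacetime → ℝ) (z : Spacetime) (v : Space) :
    ∑ ν, fourVel v ν * partialD ν f z = fderiv ℝ f z (fourVel v 0, v) := by
  have h : ((fourVel v 0, v) : Spacetime) = ∑ ν, fourVel v ν • coordVec ν := by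
    rw [Fin.sum_univ_succ, coordVec_zero]
    simp only [coordVec_succ, fourVel_succ]
    ext1
    · simp [Prod.fst_sum]
    · simp [Prod.snd_sum, sum_single_eq]
  rw [h, map_sum]
  simp [partialD]

/-- Maximum principle for the transport equation `u^ν ∂_ν f = 0` on a backward cone whose slope `c`
bounds the velocity. -/
lemma le_of_transport {f : Spacetime → ℝ} {u : Spacetime → Space} (hf : ContDiffOn ℝ 1 f Future)
    (htr : ∀ z : Spacetime, 0 < z.1 → ∑ ν, fourVel (u z) ν * partialD ν f z = 0)
    {c τ t m : ℝ} {x : Space} (hτ : 0 ≤ τ) (hτt : τ ≤ t)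
    (hc : ∀ z : Spacetime, τ ≤ z.1 → z.1 ≤ t → ‖z.2 - x‖ ≤ c * (t - z.1) →
      ‖u z‖ ≤ c * fourVel (u z) 0)
    (hm : ∀ y, ‖y - x‖ ≤ c * (t - τ) → m ≤ f (τ, y)) : m ≤ f (t, x) := by
  set K : Set Spacetime := {z | τ ≤ z.1 ∧ z.1 ≤ t ∧ ‖z.2 - x‖ ≤ c * (t - z.1)} with hK
  have hKF : K ⊆ Future := fun z hz => ⟨hτ.trans hz.1, trivial⟩
  have hKc : IsCompact K := by
    refine ((isCompact_Icc (a := τ) (b := t)).prod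
      (isCompact_closedBall x (|c| * (t - τ)))).of_isClosed_subset ?_ ?_
    · simp only [hK, Set.ofPred_and]
      exact (isClosed_le (by fun_prop) (by fun_prop)).inter
        ((isClosed_le (by fun_prop) (by fun_prop)).inter (isClosed_le (by fun_prop) (by fun_prop)))
    · rintro z ⟨h1, h2, h3⟩
      refine ⟨⟨h1, h2⟩, ?_⟩
      rw [Metric.mem_closedBall, dist_eq_norm]
      refine h3.trans ?_
      have := abs_nonneg c
      have := le_abs_self c
      nlinarith
  have htip : (t, x) ∈ K := ⟨hτt, le_rfl, by simp⟩
  refine le_of_forall_pos_le_add fun δ hδ => ?_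
  -- The tilt ε(time - τ) makes the minimum principle strict; it costs at most δ at the tip.
  obtain ⟨ε, hε, hεδ⟩ : ∃ ε > 0, ε * (t - τ) ≤ δ := by
    refine ⟨δ / (t - τ + 1), by have := sub_nonneg.2 hτt; positivity, ?_⟩
    have := sub_nonneg.2 hτt
    rw [div_mul_eq_mul_div, div_le_iff₀ (by positivity)]
    nlinarith
  obtain ⟨z, hzK, hz⟩ := hKc.exists_isMinOn ⟨_, htip⟩
    ((hf.continuousOn.mono hKF).add (f := f) (g := fun z => ε * (z.1 - τ)) (by fun_prop))
  have hz' : ∀ w ∈ K, f z + ε * (z.1 - τ) ≤ f w + ε * (w.1 - τ) := fun w hw => hz hw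
  -- A minimum above the base is impossible: moving backwards along (u⁰, u) stays in the cone by the
  -- speed bound, leaves f stationary to first order, and lowers the tilt.
  have hz0 : z.1 = τ := by
    by_contra hne
    have hlt : τ < z.1 := lt_of_le_of_ne hzK.1 (Ne.symm hne)
    have hpos : 0 < z.1 := hτ.trans_lt hlt
    have hγ := one_le_fourVel_zero (u z)
    set w : Spacetime := (fourVel (u z) 0, u z) with hw
    have hd : HasDerivAt (fun h : ℝ => f (z + h • (-w))) 0 0 := by
      have h1 := ((differentiableAt_of_future hf hpos).hasFDerivAt.hasLineDerivAt (-w))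
      have h2 : fderiv ℝ f z (-w) = 0 := by
        rw [map_neg, hw, ← sum_mul_partialD, htr z hpos, neg_zero]
      rw [h2] at h1
      exact h1
    have hg : HasDerivAt (fun h : ℝ => f (z + h • (-w)) + ε * ((z + h • (-w)).1 - τ))
        (-(ε * fourVel (u z) 0)) 0 := by
      have : HasDerivAt (fun h : ℝ => ε * ((z + h • (-w)).1 - τ)) (-(ε * fourVel (u z) 0)) 0 := by
        have h3 : (fun h : ℝ => ε * ((z + h • (-w)).1 - τ)) =
            fun h => ε * (z.1 - τ) + h * (-(ε * fourVel (u z) 0)) := by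
          ext h; simp [hw]; ring
        rw [h3]
        simpa using ((hasDerivAt_id (0 : ℝ)).mul_const (-(ε * fourVel (u z) 0))).const_add
          (ε * (z.1 - τ))
      have h4 := hd.add this
      rw [zero_add] at h4
      exact h4
    have hneg : -(ε * fourVel (u z) 0) < 0 := by
      have : 0 < ε * fourVel (u z) 0 := by positivity
      linarith
    have hev : ∀ᶠ h in 𝓝[>] (0 : ℝ), f (z + h • (-w)) + ε * ((z + h • (-w)).1 - τ) <
        f z + ε * (z.1 - τ) := by
      have := (hasDerivAt_iff_tendsto_slope.1 hg).eventually (Iio_mem_nhds hneg)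
      have := (this.filter_mono (nhdsWithin_mono _ (fun h (hh : 0 < h) => ne_of_gt hh)))
      filter_upwards [this, self_mem_nhdsWithin] with h h1 h2
      have h2' : (0 : ℝ) < h := h2
      have h1' : slope (fun h : ℝ => f (z + h • (-w)) + ε * ((z + h • (-w)).1 - τ)) 0 h < 0 := h1
      rw [slope_def_field, sub_zero, div_lt_iff₀ h2', zero_mul, sub_neg] at h1'
      simpa using h1'
    have hev2 : ∀ᶠ h in 𝓝[>] (0 : ℝ), z + h • (-w) ∈ K := by
      have hsmall : ∀ᶠ h in 𝓝[>] (0 : ℝ), h * fourVel (u z) 0 < z.1 - τ := by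
        refine Filter.Eventually.filter_mono nhdsWithin_le_nhds ?_
        refine (by fun_prop : Continuous fun h : ℝ => h * fourVel (u z) 0).continuousAt.eventually
          (Iio_mem_nhds ?_)
        simpa using hlt
      filter_upwards [hsmall, self_mem_nhdsWithin] with h h1 h2
      have h2' : (0 : ℝ) < h := h2
      have hu := hc z hzK.1 hzK.2.1 hzK.2.2
      refine ⟨?_, ?_, ?_⟩
      · simp [hw]; linarith
      · simp [hw]; nlinarith [hzK.2.1]
      · simp only [hw, Prod.snd_add, Prod.smul_snd, Prod.snd_neg, Prod.fst_add, Prod.smul_fst,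
          Prod.fst_neg, smul_eq_mul]
        calc ‖z.2 + h • -u z - x‖ = ‖(z.2 - x) + h • -u z‖ := by congr 1; abel
          _ ≤ ‖z.2 - x‖ + ‖h • -u z‖ := norm_add_le _ _
          _ = ‖z.2 - x‖ + h * ‖u z‖ := by rw [norm_smul, norm_neg, Real.norm_of_nonneg h2'.le]
          _ ≤ c * (t - z.1) + h * (c * fourVel (u z) 0) := by
            gcongr
            exact hzK.2.2
          _ = _ := by ring
    obtain ⟨h, h1, h2⟩ := (hev.and hev2).exists
    exact absurd (hz' _ h2) (not_le.2 h1)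
  have h1 := hz' _ htip
  have h2 : m ≤ f z := by
    have h3 := hm z.2 (by have := hzK.2.2; rwa [hz0] at this)
    rwa [← hz0] at h3
  rw [hz0] at h1
  simp only [sub_self, mul_zero, add_zero] at h1
  linarith

/-! ### Thermodynamic inequalities. -/

namespace IsEquationOfState

variable {ρ : ℝ → ℝ → ℝ}

lemma contDiffOn_isentropic (hρ : IsEquationOfState ρ) {s : ℝ} (hs : 0 ≤ s) :
    ContDiffOn ℝ 2 (fun m => ρ m s) (Ioi 0) :=
  hρ.contDiffOn.comp (f := fun m : ℝ => (m, s)) (by fun_prop) fun _ hm => ⟨hm, hs⟩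

lemma hasDerivAt_rho (hρ : IsEquationOfState ρ) {n s : ℝ} (hn : 0 < n) (hs : 0 ≤ s) :
    HasDerivAt (fun m => ρ m s) (deriv (fun m => ρ m s) n) n :=
  (((hρ.contDiffOn_isentropic hs).contDiffAt (Ioi_mem_nhds hn)).differentiableAt
    two_ne_zero).hasDerivAt

lemma contDiffOn_deriv_rho (hρ : IsEquationOfState ρ) {s : ℝ} (hs : 0 ≤ s) :
    ContDiffOn ℝ 1 (deriv fun m => ρ m s) (Ioi 0) :=
  ((contDiffOn_succ_iff_deriv_of_isOpen (n := 1) isOpen_Ioi).1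
    (hρ.contDiffOn_isentropic hs)).2.2

lemma hasDerivAt_deriv_rho (hρ : IsEquationOfState ρ) {n s : ℝ} (hn : 0 < n) (hs : 0 ≤ s) :
    HasDerivAt (deriv fun m => ρ m s) (deriv (deriv fun m => ρ m s) n) n :=
  (((hρ.contDiffOn_deriv_rho hs).contDiffAt (Ioi_mem_nhds hn)).differentiableAt
    one_ne_zero).hasDerivAt

lemma hasDerivAt_pressure (hρ : IsEquationOfState ρ) {n s : ℝ} (hn : 0 < n) (hs : 0 ≤ s) :
    HasDerivAt (fun m => pressure ρ m s) (n * deriv (deriv fun m => ρ m s) n) n := by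
  have := ((hasDerivAt_id n).mul (hρ.hasDerivAt_deriv_rho hn hs)).sub (hρ.hasDerivAt_rho hn hs)
  refine this.congr_deriv ?_
  simp

lemma deriv_pressure (hρ : IsEquationOfState ρ) {n s : ℝ} (hn : 0 < n) (hs : 0 ≤ s) :
    deriv (fun m => pressure ρ m s) n = n * deriv (deriv fun m => ρ m s) n :=
  (hρ.hasDerivAt_pressure hn hs).deriv

lemma deriv_deriv_rho_pos (hρ : IsEquationOfState ρ) {n s : ℝ} (hn : 0 < n) (hs : 0 ≤ s) :
    0 < deriv (deriv fun m => ρ m s) n := by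
  have := hρ.deriv_pressure_pos n s hn hs
  rw [hρ.deriv_pressure hn hs] at this
  exact pos_of_mul_pos_right this hn.le

lemma strictMonoOn_pressure (hρ : IsEquationOfState ρ) {s : ℝ} (hs : 0 ≤ s) :
    StrictMonoOn (fun m => pressure ρ m s) (Ioi 0) := by
  refine strictMonoOn_of_deriv_pos (convex_Ioi 0)
    (fun m hm => (hρ.hasDerivAt_pressure hm hs).continuousAt.continuousWithinAt) fun m hm => ?_
  rw [interior_Ioi] at hm
  exact hρ.deriv_pressure_pos m s hm hs

lemma strictMonoOn_rho (hρ : IsEquationOfState ρ) {s : ℝ} (hs : 0 ≤ s) :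
    StrictMonoOn (fun m => ρ m s) (Ioi 0) := by
  refine strictMonoOn_of_deriv_pos (convex_Ioi 0)
    (fun m hm => (hρ.hasDerivAt_rho hm hs).continuousAt.continuousWithinAt) fun m hm => ?_
  rw [interior_Ioi] at hm
  exact hρ.deriv_rho_pos m s hm hs

/-- From ∂p/∂n = n ∂²ρ/∂n², `ρ(·, s)` is strictly convex. Hence the value of ∂ρ/∂n determines n on
an isentrope. -/
lemma strictMonoOn_deriv_rho (hρ : IsEquationOfState ρ) {s : ℝ} (hs : 0 ≤ s) :
    StrictMonoOn (deriv fun m => ρ m s) (Ioi 0) := by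
  refine strictMonoOn_of_deriv_pos (convex_Ioi 0)
    (fun m hm => (hρ.hasDerivAt_deriv_rho hm hs).continuousAt.continuousWithinAt) fun m hm => ?_
  rw [interior_Ioi] at hm
  exact hρ.deriv_deriv_rho_pos hm hs

/-- Identifies ∂ρ/∂n as the enthalpy per particle, denoted h in later proofs. -/
lemma rho_add_pressure (n s : ℝ) :
    ρ n s + pressure ρ n s = n * deriv (fun m => ρ m s) n := by
  simp [pressure]

lemma pressure_pos (hρ : IsEquationOfState ρ) {n s : ℝ} (hn : 0 < n) (hs : 0 ≤ s) :
    0 < pressure ρ n s :=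
  (hρ.pressure_nonneg (n / 2) s (by positivity) hs).trans_lt
    (hρ.strictMonoOn_pressure hs (show (0 : ℝ) < n / 2 by positivity) hn (by linarith))

/-- At n = 0 the pressure is -ρ, so nonnegativity of both forces them to vanish. -/
lemma rho_vacuum (hρ : IsEquationOfState ρ) {s : ℝ} (hs : 0 ≤ s) : ρ 0 s = 0 := by
  have h1 := hρ.pressure_nonneg 0 s le_rfl hs
  have h2 := hρ.rho_nonneg 0 s le_rfl hs
  simp only [pressure, zero_mul, zero_sub] at h1
  linarith

lemma pressure_vacuum (hρ : IsEquationOfState ρ) {s : ℝ} (hs : 0 ≤ s) : pressure ρ 0 s = 0 := by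
  simp [pressure, hρ.rho_vacuum hs]

/-- Near vacuum both the energy density and the pressure become arbitrarily small. -/
lemma exists_rho_add_pressure_lt (hρ : IsEquationOfState ρ) {N s a : ℝ} (hN : 0 < N) (hs : 0 ≤ s)
    (ha : 0 < a) : ∃ n, 0 < n ∧ n ≤ N ∧ ρ n s + pressure ρ n s < a := by
  by_contra! H
  -- If n ∂ρ/∂n = ρ + p stayed above a, then ρ - a log n would be nondecreasing, and ρ would become
  -- negative near n = 0.
  have hmono : MonotoneOn (fun m => ρ m s - a * Real.log m) (Ioc 0 N) := by
    have hd : ∀ m, 0 < m → HasDerivAt (fun m => ρ m s - a * Real.log m)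
        (deriv (fun m => ρ m s) m - a * m⁻¹) m := fun m hm =>
      (hρ.hasDerivAt_rho hm hs).sub ((Real.hasDerivAt_log hm.ne').const_mul a)
    refine monotoneOn_of_deriv_nonneg (convex_Ioc 0 N)
      (fun m hm => (hd m hm.1).continuousAt.continuousWithinAt)
      (fun m hm => (hd m (interior_subset hm).1).differentiableAt.differentiableWithinAt)
      fun m hm => ?_
    have hm' := interior_subset hm
    rw [(hd m hm'.1).deriv]
    have h1 := H m hm'.1 hm'.2
    rw [rho_add_pressure] at h1
    have h2 : a * m⁻¹ ≤ deriv (fun m => ρ m s) m := by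
      rw [← div_eq_mul_inv, div_le_iff₀ hm'.1]; linarith
    linarith
  -- Chosen so that a log(N/m) = ρ(N) + 1, which would give ρ(m) ≤ -1.
  set m := N * Real.exp (-((ρ N s + 1) / a)) with hm
  have hm0 : 0 < m := by positivity
  have hmN : m ≤ N := by
    have h0 := hρ.rho_nonneg N s hN.le hs
    have : Real.exp (-((ρ N s + 1) / a)) ≤ 1 := Real.exp_le_one_iff.2 (by
      have : 0 ≤ (ρ N s + 1) / a := by positivity
      linarith)
    nlinarith
  have h1 := hmono ⟨hm0, hmN⟩ ⟨hN, le_rfl⟩ hmN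
  have h2 : Real.log m = Real.log N - (ρ N s + 1) / a := by
    rw [hm, Real.log_mul hN.ne' (Real.exp_pos _).ne', Real.log_exp]; ring
  have h3 := hρ.rho_nonneg m s hm0.le hs
  have h4 : a * ((ρ N s + 1) / a) = ρ N s + 1 := by field_simp
  simp only [h2, mul_sub, h4] at h1
  linarith

lemma soundSpeed_sq_mul (hρ : IsEquationOfState ρ) {n s : ℝ} (hn : 0 < n) (hs : 0 ≤ s) :
    soundSpeed ρ n s ^ 2 * deriv (fun m => ρ m s) n = deriv (fun m => pressure ρ m s) n := by
  have h1 := hρ.deriv_rho_pos n s hn hs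
  have h2 := hρ.deriv_pressure_pos n s hn hs
  rw [soundSpeed, Real.sq_sqrt (by positivity)]
  field_simp

lemma soundSpeed_pos (hρ : IsEquationOfState ρ) {n s : ℝ} (hn : 0 < n) (hs : 0 ≤ s) :
    0 < soundSpeed ρ n s :=
  Real.sqrt_pos.2 (div_pos (hρ.deriv_pressure_pos n s hn hs) (hρ.deriv_rho_pos n s hn hs))

/-- Along an isentrope the sound speed does not decrease with the density. -/
lemma soundSpeed_sq_le (hρ : IsEquationOfState ρ) (hA2 : SoundSpeedMonotoneInPressure ρ)
    {m₁ m₂ s : ℝ} (h₁ : 0 < m₁) (h₂ : 0 < m₂) (hs : 0 ≤ s) (h : m₁ ≤ m₂) :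
    soundSpeed ρ m₁ s ^ 2 ≤ soundSpeed ρ m₂ s ^ 2 := by
  have := hA2 m₁ m₂ s h₁ h₂ hs ((hρ.strictMonoOn_pressure hs).monotoneOn h₁ h₂ h)
  have h0 := (hρ.soundSpeed_pos h₁ hs).le
  gcongr

/-- With k the squared sound speed at N, the n-derivative of p - kρ is (η² - k) ∂ρ/∂n. By (A2) it is
nonpositive below N and nonnegative above, so N is a minimum. -/
lemma pressure_sub_le_isentropic (hρ : IsEquationOfState ρ)
    (hA2 : SoundSpeedMonotoneInPressure ρ) {N s m : ℝ} (hN : 0 < N) (hs : 0 ≤ s) (hm : 0 < m) :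
    pressure ρ N s - soundSpeed ρ N s ^ 2 * ρ N s ≤
      pressure ρ m s - soundSpeed ρ N s ^ 2 * ρ m s := by
  set k := soundSpeed ρ N s ^ 2 with hk
  have hd : ∀ m, 0 < m → HasDerivAt (fun m => pressure ρ m s - k * ρ m s)
      ((soundSpeed ρ m s ^ 2 - k) * deriv (fun m => ρ m s) m) m := fun m hm => by
    have h1 := hρ.hasDerivAt_pressure hm hs
    rw [← hρ.deriv_pressure hm hs, ← hρ.soundSpeed_sq_mul hm hs] at h1
    exact (h1.sub ((hρ.hasDerivAt_rho hm hs).const_mul k)).congr_deriv (by ring)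
  rcases le_total m N with hmN | hNm
  · have hanti : AntitoneOn (fun m => pressure ρ m s - k * ρ m s) (Ioc 0 N) := by
      refine antitoneOn_of_deriv_nonpos (convex_Ioc 0 N)
        (fun m hm => (hd m hm.1).continuousAt.continuousWithinAt)
        (fun m hm => (hd m (interior_subset hm).1).differentiableAt.differentiableWithinAt)
        fun m hm => ?_
      have hm' := interior_subset hm
      rw [(hd m hm'.1).deriv]
      have h1 := hρ.soundSpeed_sq_le hA2 hm'.1 hN hs hm'.2
      exact mul_nonpos_of_nonpos_of_nonneg (by linarith) (hρ.deriv_rho_pos m s hm'.1 hs).le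
    exact hanti ⟨hm, hmN⟩ ⟨hN, le_rfl⟩ hmN
  · have hmono : MonotoneOn (fun m => pressure ρ m s - k * ρ m s) (Ici N) := by
      refine monotoneOn_of_deriv_nonneg (convex_Ici N)
        (fun m hm => (hd m (hN.trans_le hm)).continuousAt.continuousWithinAt)
        (fun m hm => (hd m (hN.trans_le
          (interior_subset hm))).differentiableAt.differentiableWithinAt)
        fun m hm => ?_
      have hm' : N ≤ m := interior_subset hm
      rw [(hd m (hN.trans_le hm')).deriv]
      have h1 := hρ.soundSpeed_sq_le hA2 hN (hN.trans_le hm') hs hm'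
      exact mul_nonneg (by linarith) (hρ.deriv_rho_pos m s (hN.trans_le hm') hs).le
    exact hmono (mem_Ici.2 le_rfl) hNm hNm

/-- The pressure is unbounded along an isentrope. -/
lemma exists_le_pressure (hρ : IsEquationOfState ρ) (hA2 : SoundSpeedMonotoneInPressure ρ)
    {N s : ℝ} (hN : 0 < N) (hs : 0 ≤ s) (P : ℝ) : ∃ n, N ≤ n ∧ P ≤ pressure ρ n s := by
  set k := soundSpeed ρ N s ^ 2 * (N * deriv (fun m => ρ m s) N) with hk
  have hk0 : 0 < k := by
    have := hρ.soundSpeed_pos hN hs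
    have := hρ.deriv_rho_pos N s hN hs
    positivity
  -- Here n ∂p/∂n = η²(ρ + p), and both factors are at least their values at N. So p grows at least
  -- like k log n.
  have hmono : MonotoneOn (fun m => pressure ρ m s - k * Real.log m) (Ici N) := by
    have hd : ∀ m, 0 < m → HasDerivAt (fun m => pressure ρ m s - k * Real.log m)
        (deriv (fun m => pressure ρ m s) m - k * m⁻¹) m := fun m hm => by
      have h1 := hρ.hasDerivAt_pressure hm hs
      rw [← hρ.deriv_pressure hm hs] at h1
      exact h1.sub ((Real.hasDerivAt_log hm.ne').const_mul k)
    refine monotoneOn_of_deriv_nonneg (convex_Ici N)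
      (fun m hm => (hd m (hN.trans_le hm)).continuousAt.continuousWithinAt)
      (fun m hm => (hd m (hN.trans_le
        (interior_subset hm))).differentiableAt.differentiableWithinAt)
      fun m hm => ?_
    have hm' : N ≤ m := interior_subset hm
    have hm0 := hN.trans_le hm'
    rw [(hd m hm0).deriv, ← hρ.soundSpeed_sq_mul hm0 hs]
    have h1 := hρ.soundSpeed_sq_le hA2 hN hm0 hs hm'
    have h2 : N * deriv (fun m => ρ m s) N ≤ m * deriv (fun m => ρ m s) m := by
      rw [← rho_add_pressure, ← rho_add_pressure]
      exact add_le_add ((hρ.strictMonoOn_rho hs).monotoneOn hN hm0 hm')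
        ((hρ.strictMonoOn_pressure hs).monotoneOn hN hm0 hm')
    have h3 : k ≤ soundSpeed ρ m s ^ 2 * (m * deriv (fun m => ρ m s) m) := by
      have := hρ.deriv_rho_pos N s hN hs
      exact mul_le_mul h1 h2 (by positivity) (by positivity)
    have h4 : k * m⁻¹ ≤ soundSpeed ρ m s ^ 2 * deriv (fun m => ρ m s) m := by
      rw [← div_eq_mul_inv, div_le_iff₀ hm0]; linarith
    linarith
  set Q := max 0 (P - pressure ρ N s) with hQ
  set m := N * Real.exp (Q / k) with hm
  have hQ0 : 0 ≤ Q := le_max_left _ _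
  have hmN : N ≤ m := by
    have : 1 ≤ Real.exp (Q / k) := Real.one_le_exp (by positivity)
    nlinarith
  refine ⟨m, hmN, ?_⟩
  have h1 := hmono (mem_Ici.2 le_rfl) hmN hmN
  have h2 : Real.log m = Real.log N + Q / k := by
    rw [hm, Real.log_mul hN.ne' (Real.exp_pos _).ne', Real.log_exp]
  have h4 : k * (Q / k) = Q := by field_simp
  simp only [h2, mul_add, h4] at h1
  have h5 : P - pressure ρ N s ≤ Q := le_max_right _ _
  linarith

/-- The basic thermodynamic inequality `p - p̄ ≥ η̄² (ρ - ρ̄)` for states of entropy at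
least `s̄`. -/
lemma soundSpeed_sq_mul_rho_sub_le (hρ : IsEquationOfState ρ) (hA1 : RhoAntitoneInEntropy ρ)
    (hA2 : SoundSpeedMonotoneInPressure ρ) {N S n s : ℝ} (hN : 0 < N) (hS : 0 ≤ S) (hn : 0 ≤ n)
    (hs : S ≤ s) :
    soundSpeed ρ N S ^ 2 * (ρ n s - ρ N S) ≤ pressure ρ n s - pressure ρ N S := by
  have hs0 := hS.trans hs
  rcases hn.eq_or_lt with rfl | hn
  -- At vacuum the claim reads p̄ ≤ η̄²ρ̄; it follows from the isentropic inequality along states of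
  -- the isentrope S approaching vacuum.
  · rw [hρ.rho_vacuum hs0, hρ.pressure_vacuum hs0]
    suffices pressure ρ N S - soundSpeed ρ N S ^ 2 * ρ N S ≤ 0 by linarith
    refine le_of_forall_pos_le_add fun a ha => ?_
    obtain ⟨m, hm0, -, hm⟩ := hρ.exists_rho_add_pressure_lt hN hS ha
    have h1 := hρ.pressure_sub_le_isentropic hA2 hN hS hm0
    have h2 := hρ.rho_nonneg m S hm0.le hS
    have h3 : 0 ≤ soundSpeed ρ N S ^ 2 * ρ m S := by positivity
    linarith
  · have hP := hρ.pressure_pos hn hs0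
    obtain ⟨a, ha0, haN, ha⟩ := hρ.exists_rho_add_pressure_lt hN hS hP
    obtain ⟨b, hNb, hb⟩ := hρ.exists_le_pressure hA2 hN hS (pressure ρ n s)
    have hra := hρ.rho_nonneg a S ha0.le hS
    -- Compare with the state of entropy S and the same pressure, which exists because a and b
    -- bracket that pressure. By (A1) it has at least the energy density of (n, s), so the
    -- isentropic inequality carries over.
    obtain ⟨m, hm, hmP⟩ := intermediate_value_Icc (haN.trans hNb)
      (f := fun m => pressure ρ m S) (fun m hm =>
        (hρ.hasDerivAt_pressure (ha0.trans_le hm.1) hS).continuousAt.continuousWithinAt)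
      (show pressure ρ n s ∈ Icc _ _ from ⟨by linarith, hb⟩)
    have hm0 := ha0.trans_le hm.1
    have h1 := hA1 m S n s hm0 hS hn hs0 hmP hs
    have h2 := hρ.pressure_sub_le_isentropic hA2 hN hS hm0
    have h3 : soundSpeed ρ N S ^ 2 * ρ n s ≤ soundSpeed ρ N S ^ 2 * ρ m S := by gcongr
    simp only at hmP
    linarith

/-- The relative energy density on an isentrope dominates the square of the enthalpy
perturbation. -/
lemma eventually_sq_le_relative_rho (hρ : IsEquationOfState ρ) {N S κ : ℝ} (hN : 0 < N)
    (hS : 0 ≤ S) (hκ : deriv (deriv fun m => ρ m S) N < κ) :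
    ∀ᶠ n in 𝓝 N, 0 < n ∧ (deriv (fun m => ρ m S) n - deriv (fun m => ρ m S) N) ^ 2 ≤
      2 * κ * (ρ n S - ρ N S - deriv (fun m => ρ m S) N * (n - N)) := by
  set h := deriv fun m => ρ m S with hh
  have hcont : ContinuousAt (deriv h) N :=
    ((hρ.contDiffOn_deriv_rho hS).continuousOn_deriv_of_isOpen isOpen_Ioi le_rfl).continuousAt
      (Ioi_mem_nhds hN)
  obtain ⟨δ, hδ, hball⟩ := Metric.eventually_nhds_iff_ball.1
    ((hcont.eventually (Iio_mem_nhds hκ)).and (Ioi_mem_nhds hN))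
  have hκ0 : 0 < κ := (hρ.deriv_deriv_rho_pos hN hS).trans hκ
  -- G' = 2(h - h̄)(κ - h'), so G has minimum 0 at N throughout a neighbourhood where h' < κ.
  set G : ℝ → ℝ := fun n => 2 * κ * (ρ n S - ρ N S - h N * (n - N)) - (h n - h N) ^ 2 with hG
  have hd : ∀ n, 0 < n → HasDerivAt G (2 * (h n - h N) * (κ - deriv h n)) n := fun n hn => by
    have h1 := (((hρ.hasDerivAt_rho hn hS).sub_const (ρ N S)).sub
      (((hasDerivAt_id n).sub_const N).const_mul (h N))).const_mul (2 * κ)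
    have h2 := ((hρ.hasDerivAt_deriv_rho hn hS).sub_const (h N)).pow 2
    refine (h1.sub h2).congr_deriv ?_
    simp [← hh]; ring
  have hGN : G N = 0 := by simp [hG]
  have hmono := (hρ.strictMonoOn_deriv_rho hS).monotoneOn
  filter_upwards [Metric.ball_mem_nhds N hδ] with n hn
  refine ⟨(hball n hn).2, ?_⟩
  suffices 0 ≤ G n by simp only [hG] at this; linarith
  rw [← hGN]
  rcases le_total n N with hnN | hNn
  · have hsub : Icc n N ⊆ Metric.ball N δ := by
      intro m hm
      rw [Metric.mem_ball, Real.dist_eq, abs_sub_lt_iff] at hn ⊢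
      constructor <;> linarith [hm.1, hm.2]
    have hanti : AntitoneOn G (Icc n N) := by
      refine antitoneOn_of_deriv_nonpos (convex_Icc n N)
        (fun m hm => (hd m (hball m (hsub hm)).2).continuousAt.continuousWithinAt)
        (fun m hm => (hd m (hball m (hsub
          (interior_subset hm))).2).differentiableAt.differentiableWithinAt) fun m hm => ?_
      have hm' := interior_subset hm
      obtain ⟨hb1, hb2⟩ := hball m (hsub hm')
      rw [(hd m hb2).deriv]
      have hb1' : deriv h m < κ := hb1
      have : h m ≤ h N := hmono hb2 hN hm'.2
      exact mul_nonpos_of_nonpos_of_nonneg (by linarith) (by linarith)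
    exact hanti ⟨le_rfl, hnN⟩ ⟨hnN, le_rfl⟩ hnN
  · have hsub : Icc N n ⊆ Metric.ball N δ := by
      intro m hm
      rw [Metric.mem_ball, Real.dist_eq, abs_sub_lt_iff] at hn ⊢
      constructor <;> linarith [hm.1, hm.2]
    have hmono' : MonotoneOn G (Icc N n) := by
      refine monotoneOn_of_deriv_nonneg (convex_Icc N n)
        (fun m hm => (hd m (hball m (hsub hm)).2).continuousAt.continuousWithinAt)
        (fun m hm => (hd m (hball m (hsub
          (interior_subset hm))).2).differentiableAt.differentiableWithinAt) fun m hm => ?_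
      have hm' := interior_subset hm
      obtain ⟨hb1, hb2⟩ := hball m (hsub hm')
      rw [(hd m hb2).deriv]
      have hb1' : deriv h m < κ := hb1
      have : h N ≤ h m := hmono hN hb2 hm'.1
      exact mul_nonneg (by linarith) (by linarith)
    exact hmono' ⟨le_rfl, hNn⟩ ⟨hNn, le_rfl⟩ hNn

end IsEquationOfState

/-! ### The relative energy current near the quiet state. -/

/-- The relative energy current of the state `(n, s, v)` with respect to the quiet state
`(nbar, sbar, 0)`: the combination of energy, particle number and a constant that is of second
order at the quiet state. -/
def relativeCurrent (ρ : ℝ → ℝ → ℝ) (nbar sbar n s : ℝ) (v : Space) (ν : Fin 4) : ℝ :=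
  energyTensor ρ n s v 0 ν - deriv (fun m => ρ m sbar) nbar * (n * fourVel v ν) -
    pressure ρ nbar sbar * minkowski 0 ν

/-- Separates a kinetic part, with factor u⁰ - 1, from the gap between the convex function `ρ(·, S)`
and its tangent at N. Near the quiet state both are nonnegative. -/
lemma relativeCurrent_zero (ρ : ℝ → ℝ → ℝ) (N S n : ℝ) (v : Space) :
    relativeCurrent ρ N S n S v 0 =
      n * (fourVel v 0 - 1) * (deriv (fun m => ρ m S) n * fourVel v 0 +
        (deriv (fun m => ρ m S) n - deriv (fun m => ρ m S) N)) +
      (ρ n S - ρ N S - deriv (fun m => ρ m S) N * (n - N)) := by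
  simp only [relativeCurrent, energyTensor, minkowski, pressure, if_true]
  ring

lemma relativeCurrent_succ (ρ : ℝ → ℝ → ℝ) (N S n : ℝ) (v : Space) (i : Fin 3) :
    relativeCurrent ρ N S n S v i.succ =
      n * (deriv (fun m => ρ m S) n * fourVel v 0 - deriv (fun m => ρ m S) N) * v i := by
  have : (0 : Fin 4) ≠ i.succ := (Fin.succ_ne_zero i).symm
  simp only [relativeCurrent, energyTensor, IsEquationOfState.rho_add_pressure, minkowski,
    if_neg this, fourVel_succ]
  ring

/-- Near the quiet state the relative energy current is timelike with respect to every cone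
of slope larger than the sound speed. -/
lemma eventually_relativeCurrent {ρ : ℝ → ℝ → ℝ} (hρ : IsEquationOfState ρ) {N S c : ℝ}
    (hN : 0 < N) (hS : 0 ≤ S) (hc : soundSpeed ρ N S < c) :
    ∀ᶠ q : ℝ × Space in 𝓝 (N, 0),
      0 ≤ relativeCurrent ρ N S q.1 S q.2 0 ∧
      (relativeCurrent ρ N S q.1 S q.2 0 = 0 → q.1 = N ∧ q.2 = 0) ∧
      ∀ y : Space, -(∑ i : Fin 3, y i * relativeCurrent ρ N S q.1 S q.2 i.succ) ≤
        ‖y‖ * (c * relativeCurrent ρ N S q.1 S q.2 0) := by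
  set h := deriv fun m => ρ m S with hh
  have hη := hρ.soundSpeed_pos hN hS
  have hc0 : 0 < c := hη.trans hc
  have hhN : 0 < h N := hρ.deriv_rho_pos N S hN hS
  -- There is room for κ because N h'(N) = η̄²h̄ < c²h̄.
  obtain ⟨κ, hκ1, hκ2⟩ : ∃ κ, deriv h N < κ ∧ N * κ < c ^ 2 * h N := by
    have h1 := hρ.soundSpeed_sq_mul hN hS
    rw [hρ.deriv_pressure hN hS] at h1
    have h2 : soundSpeed ρ N S ^ 2 * h N < c ^ 2 * h N := by gcongr
    have h3 : deriv h N < c ^ 2 * h N / N := by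
      rw [lt_div_iff₀ hN]; linarith
    obtain ⟨κ, h4, h5⟩ := exists_between h3
    refine ⟨κ, h4, ?_⟩
    rw [lt_div_iff₀ hN] at h5; linarith
  have hκ0 : 0 < κ := (hρ.deriv_deriv_rho_pos hN hS).trans hκ1
  have hG : ∀ᶠ q : ℝ × Space in 𝓝 (N, 0), 0 < q.1 ∧ (h q.1 - h N) ^ 2 ≤
      2 * κ * (ρ q.1 S - ρ N S - h N * (q.1 - N)) :=
    continuous_fst.continuousAt.eventually (hρ.eventually_sq_le_relative_rho hN hS hκ1)
  -- At (N, 0) this reads Nκ/c < c h̄, so it persists nearby. It is the coefficient inequality left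
  -- after removing the factor n(γ - 1) in `hmain`.
  have hstrict : ∀ᶠ q : ℝ × Space in 𝓝 (N, 0),
      q.1 * κ * (fourVel q.2 0 + 1) / (2 * c) + ‖q.2‖ * h q.1 <
        c * (h q.1 * fourVel q.2 0 + (h q.1 - h N)) := by
    have hhc : ContinuousAt (fun q : ℝ × Space => h q.1) (N, 0) :=
      ContinuousAt.comp (g := h) (f := Prod.fst)
        (hρ.hasDerivAt_deriv_rho hN hS).continuousAt continuous_fst.continuousAt
    have hγc : ContinuousAt (fun q : ℝ × Space => fourVel q.2 0) (N, 0) := by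
      simp only [fourVel_zero]; fun_prop
    have hlhs : ContinuousAt (fun q : ℝ × Space =>
        q.1 * κ * (fourVel q.2 0 + 1) / (2 * c) + ‖q.2‖ * h q.1) (N, 0) :=
      (((continuousAt_fst.mul continuousAt_const).mul (hγc.add continuousAt_const)).div_const
        (2 * c)).add (continuousAt_snd.norm.mul hhc)
    have hrhs : ContinuousAt (fun q : ℝ × Space =>
        c * (h q.1 * fourVel q.2 0 + (h q.1 - h N))) (N, 0) :=
      continuousAt_const.mul ((hhc.mul hγc).add (hhc.sub continuousAt_const))
    refine hlhs.eventually_lt hrhs ?_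
    simp only [fourVel_zero, norm_zero]
    norm_num
    rw [div_lt_iff₀ (by positivity)]
    nlinarith
  filter_upwards [hG, hstrict] with ⟨n, v⟩ ⟨hn, hG⟩ hlt
  simp only at hn hG hlt ⊢
  simp only [relativeCurrent_succ, relativeCurrent_zero, ← hh]
  set γ := fourVel v 0 with hγ
  set G := ρ n S - ρ N S - h N * (n - N) with hGdef
  have hγ1 : 1 ≤ γ := one_le_fourVel_zero v
  have hγ2 : γ ^ 2 = 1 + ‖v‖ ^ 2 := fourVel_zero_sq v
  have hhn : 0 < h n := hρ.deriv_rho_pos n S hn hS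
  have hG0 : 0 ≤ G := by
    have : 0 ≤ 2 * κ * G := (sq_nonneg _).trans hG
    exact nonneg_of_mul_nonneg_right this (by positivity)
  have hbr : 0 < h n * γ + (h n - h N) := by
    refine pos_of_mul_pos_right (a := c) (lt_of_le_of_lt ?_ hlt) hc0.le
    positivity
  have ha0 : 0 ≤ n * (γ - 1) * (h n * γ + (h n - h N)) :=
    mul_nonneg (mul_nonneg hn.le (by linarith)) hbr.le
  refine ⟨by linarith, fun h0 => ?_, fun y => ?_⟩
  · have h1 : n * (γ - 1) * (h n * γ + (h n - h N)) = 0 := by linarith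
    have h2 : G = 0 := by linarith
    have h3 : γ = 1 := by
      rcases mul_eq_zero.1 h1 with h3 | h3
      · rcases mul_eq_zero.1 h3 with h4 | h4 <;> linarith
      · exact absurd h3 hbr.ne'
    have h4 : h n = h N := by
      rw [h2, mul_zero] at hG
      have := pow_eq_zero_iff two_ne_zero |>.1 (le_antisymm hG (sq_nonneg _))
      linarith
    refine ⟨(hρ.strictMonoOn_deriv_rho hS).injOn hn hN h4, ?_⟩
    rw [h3] at hγ2
    have : ‖v‖ ^ 2 = 0 := by linarith
    simpa using this
  · set w := ‖v‖ with hw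
    have hw0 : 0 ≤ w := norm_nonneg v
    have hcs : |∑ i : Fin 3, y i * v i| ≤ ‖y‖ * w := by
      have := abs_real_inner_le_norm y v
      simpa [PiLp.inner_apply, mul_comm] using this
    have hrew : ∑ i : Fin 3, y i * (n * (h n * γ - h N) * v i) =
        (n * (h n * γ - h N)) * ∑ i : Fin 3, y i * v i := by
      rw [Finset.mul_sum]
      exact Finset.sum_congr rfl fun i _ => by ring
    rw [hrew]
    -- Split hγ - h̄ into h - h̄ and h(γ - 1). Young's inequality absorbs the first term into cG,
    -- leaving n²|v|²κ/(2c). As |v|² = (γ - 1)(γ + 1), this and the second term carry the factor n(γ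
    -- - 1), and `hstrict` applies.
    have hmain : |n * (h n * γ - h N)| * w ≤ c * (n * (γ - 1) * (h n * γ + (h n - h N)) + G) := by
      rw [abs_mul, abs_of_pos hn]
      have h1 : |h n * γ - h N| ≤ |h n - h N| + h n * (γ - 1) := by
        have : h n * γ - h N = (h n - h N) + h n * (γ - 1) := by ring
        rw [this]
        refine (abs_add_le _ _).trans ?_
        rw [abs_of_nonneg (mul_nonneg hhn.le (by linarith) : 0 ≤ h n * (γ - 1))]
      have h2 : n * w * |h n - h N| ≤ c * G + n ^ 2 * w ^ 2 * κ / (2 * c) := by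
        have h3 : |h n - h N| ^ 2 ≤ 2 * κ * G := by rwa [sq_abs]
        have h4 : 0 ≤ (c * |h n - h N| - n * w * κ) ^ 2 := sq_nonneg _
        have h5 : 2 * c * κ * (n * w * |h n - h N|) ≤
            2 * c * κ * (c * G + n ^ 2 * w ^ 2 * κ / (2 * c)) := by
          have h6 : 2 * c * κ * (c * G + n ^ 2 * w ^ 2 * κ / (2 * c)) =
              c ^ 2 * (2 * κ * G) + n ^ 2 * w ^ 2 * κ ^ 2 := by field_simp
          rw [h6]
          have h7 : c ^ 2 * |h n - h N| ^ 2 ≤ c ^ 2 * (2 * κ * G) := by gcongr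
          linarith
        exact le_of_mul_le_mul_left h5 (by positivity)
      have h3 : n * (γ - 1) * (n * κ * (γ + 1) / (2 * c) + w * h n) ≤
          n * (γ - 1) * (c * (h n * γ + (h n - h N))) :=
        mul_le_mul_of_nonneg_left hlt.le (mul_nonneg hn.le (by linarith))
      have h4 : n * (γ - 1) * (n * κ * (γ + 1) / (2 * c) + w * h n) =
          n ^ 2 * w ^ 2 * κ / (2 * c) + n * w * (h n * (γ - 1)) := by
        have : w ^ 2 = (γ - 1) * (γ + 1) := by linarith
        rw [this]; ring
      have h5 : n * |h n * γ - h N| * w ≤ n * w * |h n - h N| + n * w * (h n * (γ - 1)) := by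
        have := mul_le_mul_of_nonneg_left h1 (mul_nonneg hn.le hw0)
        linarith
      linarith
    calc -(n * (h n * γ - h N) * ∑ i : Fin 3, y i * v i)
        ≤ |n * (h n * γ - h N)| * |∑ i : Fin 3, y i * v i| := by
          rw [← abs_mul]; exact neg_le_abs _
      _ ≤ |n * (h n * γ - h N)| * (‖y‖ * w) := by gcongr
      _ = ‖y‖ * (|n * (h n * γ - h N)| * w) := by ring
      _ ≤ _ := by gcongr

/-! ### Local conservation laws, including at vacuum. -/

lemma partialD_add {f g : Spacetime → ℝ} {z : Spacetime} (hf : DifferentiableAt ℝ f z)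
    (hg : DifferentiableAt ℝ g z) (ν : Fin 4) :
    partialD ν (fun y => f y + g y) z = partialD ν f z + partialD ν g z := by
  simp [partialD, fderiv_fun_add hf hg]

lemma partialD_sub {f g : Spacetime → ℝ} {z : Spacetime} (hf : DifferentiableAt ℝ f z)
    (hg : DifferentiableAt ℝ g z) (ν : Fin 4) :
    partialD ν (fun y => f y - g y) z = partialD ν f z - partialD ν g z := by
  simp [partialD, fderiv_fun_sub hf hg]

lemma partialD_mul {f g : Spacetime → ℝ} {z : Spacetime} (hf : DifferentiableAt ℝ f z)
    (hg : DifferentiableAt ℝ g z) (ν : Fin 4) :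
    partialD ν (fun y => f y * g y) z = partialD ν f z * g z + f z * partialD ν g z := by
  simp [partialD, fderiv_fun_mul hf hg]; ring

lemma partialD_const (a : ℝ) (ν : Fin 4) (z : Spacetime) : partialD ν (fun _ => a) z = 0 := by
  simp [partialD]

namespace IsGlobalC1Solution

variable {ρ : ℝ → ℝ → ℝ} {n₀ s₀ : Space → ℝ} {u₀ : Space → Space}
  {n s : Spacetime → ℝ} {u : Spacetime → Space}

lemma contDiffOn_fourVel (sol : IsGlobalC1Solution ρ n₀ s₀ u₀ n s u) (ν : Fin 4) :
    ContDiffOn ℝ 1 (fun y => fourVel (u y) ν) Future := by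
  refine Fin.cases ?_ (fun i => ?_) ν
  · simp only [fourVel_zero]
    exact (contDiffOn_const.add (sol.contDiff_u.norm_sq ℝ)).sqrt fun z _ => by positivity
  · simp only [fourVel_succ]
    exact contDiffOn_euclidean.1 sol.contDiff_u i

lemma contDiffOn_energyTensor (sol : IsGlobalC1Solution ρ n₀ s₀ u₀ n s u) (μ ν : Fin 4) :
    ContDiffOn ℝ 1 (fun y => energyTensor ρ (n y) (s y) (u y) μ ν) Future :=
  (((sol.contDiff_rho.add sol.contDiff_pressure).mul (sol.contDiffOn_fourVel μ)).mul
    (sol.contDiffOn_fourVel ν)).add (sol.contDiff_pressure.mul contDiffOn_const)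

/-- The energy equation `u^ν ∂_ν ρ + (ρ + p) ∂_ν u^ν = 0`; it also holds at vacuum points. -/
lemma energy_equation (sol : IsGlobalC1Solution ρ n₀ s₀ u₀ n s u) (hρ : IsEquationOfState ρ)
    {z : Spacetime} (hz : 0 < z.1) :
    ∑ ν, fourVel (u z) ν * partialD ν (fun y => ρ (n y) (s y)) z +
      (ρ (n z) (s z) + pressure ρ (n z) (s z)) *
        ∑ ν, partialD ν (fun y => fourVel (u y) ν) z = 0 := by
  have hs0 := sol.s_nonneg z hz.le
  have hdn := differentiableAt_of_future sol.contDiff_n hz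
  have hds := differentiableAt_of_future sol.contDiff_s hz
  have hdu := fun ν => differentiableAt_of_future (sol.contDiffOn_fourVel ν) hz
  rcases (sol.n_nonneg z hz.le).eq_or_lt with hn | hn
  -- At a vacuum point ρ attains its minimum 0, so its gradient vanishes, and ρ + p = 0 there.
  · have hmin : IsLocalMin (fun y => ρ (n y) (s y)) z := by
      filter_upwards [Future_mem_nhds hz] with y hy
      rw [← hn, hρ.rho_vacuum hs0]
      exact hρ.rho_nonneg _ _ (sol.n_nonneg y hy.1) (sol.s_nonneg y hy.1)
    rw [← hn, hρ.rho_vacuum hs0, hρ.pressure_vacuum hs0]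
    simp [partialD, hmin.fderiv_eq_zero]
  -- The state may lie on the boundary s = 0, hence derivatives within D. Only the n-component of
  -- the differential matters, since s is constant along the flow.
  · set D : Set (ℝ × ℝ) := Ioi 0 ×ˢ Ici 0
    have hmem : (n z, s z) ∈ D := ⟨hn, hs0⟩
    have hL := ((hρ.contDiffOn.differentiableOn two_ne_zero) _ hmem).hasFDerivWithinAt
    set L := fderivWithin ℝ (fun q : ℝ × ℝ => ρ q.1 q.2) D (n z, s z)
    have hL1 : L (1, 0) = deriv (fun m => ρ m (s z)) (n z) := by
      have h1 : HasFDerivWithinAt (fun m : ℝ => (m, s z)) (ContinuousLinearMap.inl ℝ ℝ ℝ)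
          (Ioi 0) (n z) := (hasFDerivAt_prodMk_left (n z) (s z)).hasFDerivWithinAt
      have h2 := (HasFDerivWithinAt.comp (n z) hL h1
        (show MapsTo _ (Ioi 0) D from fun m hm => ⟨hm, hs0⟩)).hasFDerivAt (Ioi_mem_nhds hn)
      have h3 := h2.hasDerivAt.deriv
      simpa [Function.comp_def] using h3.symm
    have hcomp : HasFDerivAt (fun y => ρ (n y) (s y))
        (L.comp ((fderiv ℝ n z).prod (fderiv ℝ s z))) z := by
      set W : Set Spacetime := {y | y ∈ Future ∧ 0 < n y}
      have hW : W ∈ 𝓝 z := by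
        filter_upwards [Future_mem_nhds hz, hdn.continuousAt.eventually (Ioi_mem_nhds hn)]
          with y h1 h2 using ⟨h1, h2⟩
      have h1 : HasFDerivWithinAt (fun y => (n y, s y)) ((fderiv ℝ n z).prod (fderiv ℝ s z)) W z :=
        (hdn.hasFDerivAt.prodMk hds.hasFDerivAt).hasFDerivWithinAt
      exact (HasFDerivWithinAt.comp z hL h1
        (show MapsTo _ W D from fun y hy => ⟨hy.2, sol.s_nonneg y hy.1.1⟩)).hasFDerivAt hW
    rw [sum_mul_partialD, hcomp.fderiv]
    have had := sol.adiabatic z hz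
    have hco := sol.continuity z hz
    rw [sum_mul_partialD] at had
    have hsum : ∑ ν, partialD ν (fun y => n y * fourVel (u y) ν) z =
        fderiv ℝ n z (fourVel (u z) 0, u z) +
          n z * ∑ ν, partialD ν (fun y => fourVel (u y) ν) z := by
      rw [← sum_mul_partialD, Finset.mul_sum, ← Finset.sum_add_distrib]
      refine Finset.sum_congr rfl fun ν _ => ?_
      rw [partialD_mul hdn (hdu ν)]
      ring
    rw [hsum] at hco
    rw [IsEquationOfState.rho_add_pressure, ContinuousLinearMap.comp_apply,
      ContinuousLinearMap.prod_apply, had]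
    have hlin : L (fderiv ℝ n z (fourVel (u z) 0, u z), 0) =
        fderiv ℝ n z (fourVel (u z) 0, u z) * L (1, 0) := by
      rw [← smul_eq_mul, ← map_smul]
      simp
    rw [hlin, hL1]
    linear_combination deriv (fun m => ρ m (s z)) (n z) * hco

/-- Conservation of energy and momentum, `∂_ν T^{μν} = 0`. -/
lemma conservation (sol : IsGlobalC1Solution ρ n₀ s₀ u₀ n s u) (hρ : IsEquationOfState ρ)
    {z : Spacetime} (hz : 0 < z.1) (μ : Fin 4) :
    ∑ ν, partialD ν (fun y => energyTensor ρ (n y) (s y) (u y) μ ν) z = 0 := by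
  have hdr := differentiableAt_of_future sol.contDiff_rho hz
  have hdp := differentiableAt_of_future sol.contDiff_pressure hz
  have hdu := fun ν => differentiableAt_of_future (sol.contDiffOn_fourVel ν) hz
  have hterm : ∀ ν, partialD ν (fun y => energyTensor ρ (n y) (s y) (u y) μ ν) z =
      ((partialD ν (fun y => ρ (n y) (s y)) z +
          partialD ν (fun y => pressure ρ (n y) (s y)) z) * fourVel (u z) μ +
        (ρ (n z) (s z) + pressure ρ (n z) (s z)) * partialD ν (fun y => fourVel (u y) μ) z) *
          fourVel (u z) ν +
        (ρ (n z) (s z) + pressure ρ (n z) (s z)) * fourVel (u z) μ *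
          partialD ν (fun y => fourVel (u y) ν) z +
        partialD ν (fun y => pressure ρ (n y) (s y)) z * minkowski μ ν := by
    intro ν
    simp only [energyTensor]
    have hH := hdr.fun_add hdp
    have hHu := hH.fun_mul (hdu μ)
    rw [partialD_add (hHu.fun_mul (hdu ν)) (hdp.fun_mul (differentiableAt_const _)),
      partialD_mul hHu (hdu ν), partialD_mul hH (hdu μ), partialD_add hdr hdp,
      partialD_mul hdp (differentiableAt_const _), partialD_const]
    ring
  simp only [hterm]
  have he := sol.energy_equation hρ hz
  have hm := sol.momentum z hz μ
  simp only [Fin.sum_univ_four] at he hm ⊢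
  -- The divergence of T is u^μ times the energy equation plus the momentum equation.
  linear_combination fourVel (u z) μ * he + hm

/-- Conservation of the relative energy current. -/
lemma relativeCurrent_conservation (sol : IsGlobalC1Solution ρ n₀ s₀ u₀ n s u)
    (hρ : IsEquationOfState ρ) (N S : ℝ) {z : Spacetime} (hz : 0 < z.1) :
    ∑ ν, partialD ν (fun y => relativeCurrent ρ N S (n y) (s y) (u y) ν) z = 0 := by
  have hdT := fun ν => differentiableAt_of_future (sol.contDiffOn_energyTensor 0 ν) hz
  have hdn := differentiableAt_of_future sol.contDiff_n hz
  have hdu := fun ν => differentiableAt_of_future (sol.contDiffOn_fourVel ν) hz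
  have hterm : ∀ ν, partialD ν (fun y => relativeCurrent ρ N S (n y) (s y) (u y) ν) z =
      partialD ν (fun y => energyTensor ρ (n y) (s y) (u y) 0 ν) z -
        deriv (fun m => ρ m S) N * partialD ν (fun y => n y * fourVel (u y) ν) z := by
    intro ν
    simp only [relativeCurrent]
    have hnu := hdn.fun_mul (hdu ν)
    have hcnu := (differentiableAt_const (x := z) (deriv (fun m => ρ m S) N)).fun_mul hnu
    rw [partialD_sub ((hdT ν).fun_sub hcnu) (differentiableAt_const _),
      partialD_sub (hdT ν) hcnu, partialD_mul (differentiableAt_const _) hnu, partialD_const,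
      partialD_const]
    ring
  simp only [hterm]
  rw [Finset.sum_sub_distrib, ← Finset.mul_sum, sol.conservation hρ hz, sol.continuity z hz]
  simp

lemma contDiffOn_relativeCurrent (sol : IsGlobalC1Solution ρ n₀ s₀ u₀ n s u) (N S : ℝ)
    (ν : Fin 4) :
    ContDiffOn ℝ 1 (fun y => relativeCurrent ρ N S (n y) (s y) (u y) ν) Future :=
  ((sol.contDiffOn_energyTensor 0 ν).sub (contDiffOn_const.mul
    (sol.contDiff_n.mul (sol.contDiffOn_fourVel ν)))).sub contDiffOn_const

end IsGlobalC1Solution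

/-! ### Energy estimate in backward cones and finite propagation speed. -/

/-- The quadratic function whose positivity region below `t₁` is the open backward cone of slope
`c` with tip `(t₁, x₁)`. -/
def coneFun (c t₁ : ℝ) (x₁ : Space) (z : Spacetime) : ℝ :=
  c ^ 2 * (t₁ - z.1) ^ 2 - ‖z.2 - x₁‖ ^ 2

lemma contDiff_coneFun (c t₁ : ℝ) (x₁ : Space) : ContDiff ℝ 1 (coneFun c t₁ x₁) := by
  unfold coneFun
  exact (contDiff_const.mul ((contDiff_const.sub contDiff_fst).pow 2)).sub
    ((contDiff_snd.sub contDiff_const).norm_sq ℝ)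

lemma fderiv_coneFun (c t₁ : ℝ) (x₁ : Space) (z w : Spacetime) :
    fderiv ℝ (coneFun c t₁ x₁) z w =
      -(2 * c ^ 2 * (t₁ - z.1) * w.1) - 2 * inner ℝ (z.2 - x₁) w.2 := by
  have h1 : HasFDerivAt (fun z : Spacetime => ‖z.2 - x₁‖ ^ 2) _ z :=
    ((hasFDerivAt_snd (𝕜 := ℝ) (p := z)).sub_const x₁).norm_sq
  have h2 : HasFDerivAt (fun z : Spacetime => c ^ 2 * (t₁ - z.1) ^ 2) _ z :=
    (((hasFDerivAt_fst (𝕜 := ℝ) (p := z)).const_sub t₁).pow 2).const_mul (c ^ 2)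
  have h3 : HasFDerivAt (coneFun c t₁ x₁) _ z := h2.sub h1
  rw [h3.fderiv]
  simp [inner_sub_left]
  ring

lemma partialD_coneFun_zero (c t₁ : ℝ) (x₁ : Space) (z : Spacetime) :
    partialD 0 (coneFun c t₁ x₁) z = -(2 * c ^ 2 * (t₁ - z.1)) := by
  simp [partialD, fderiv_coneFun, coordVec_zero]

lemma partialD_coneFun_succ (c t₁ : ℝ) (x₁ : Space) (z : Spacetime) (i : Fin 3) :
    partialD i.succ (coneFun c t₁ x₁) z = -(2 * (z.2 - x₁) i) := by
  simp [partialD, fderiv_coneFun, coordVec_succ, EuclideanSpace.inner_single_right]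

lemma coneFun_pos_iff {c t₁ : ℝ} {x₁ : Space} {z : Spacetime} (hc : 0 ≤ c) (hz : z.1 ≤ t₁) :
    0 < coneFun c t₁ x₁ z ↔ ‖z.2 - x₁‖ < c * (t₁ - z.1) := by
  rw [coneFun, sub_pos, ← mul_pow]
  exact pow_lt_pow_iff_left₀ (norm_nonneg _) (mul_nonneg hc (by linarith)) two_ne_zero

/-- A smooth weight supported in the backward cone. -/
def coneWeight (c t₁ : ℝ) (x₁ : Space) (z : Spacetime) : ℝ :=
  expNegInvGlue (coneFun c t₁ x₁ z)

lemma contDiff_coneWeight (c t₁ : ℝ) (x₁ : Space) : ContDiff ℝ 1 (coneWeight c t₁ x₁) :=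
  (expNegInvGlue.contDiff (n := 1)).comp (contDiff_coneFun c t₁ x₁)

lemma deriv_expNegInvGlue_of_nonpos {y : ℝ} (hy : y ≤ 0) : deriv expNegInvGlue y = 0 := by
  refine IsLocalMin.deriv_eq_zero (Eventually.of_forall fun w => ?_)
  rw [expNegInvGlue.zero_of_nonpos hy]
  exact expNegInvGlue.nonneg w

lemma partialD_coneWeight (c t₁ : ℝ) (x₁ : Space) (z : Spacetime) (ν : Fin 4) :
    partialD ν (coneWeight c t₁ x₁) z =
      deriv expNegInvGlue (coneFun c t₁ x₁ z) * partialD ν (coneFun c t₁ x₁) z := by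
  have h1 : HasDerivAt expNegInvGlue _ (coneFun c t₁ x₁ z) :=
    ((expNegInvGlue.contDiff (n := 1)).differentiable one_ne_zero _).hasDerivAt
  have h2 : HasFDerivAt (coneFun c t₁ x₁) _ z :=
    ((contDiff_coneFun c t₁ x₁).differentiable one_ne_zero z).hasFDerivAt
  have h3 : HasFDerivAt (coneWeight c t₁ x₁) _ z := h1.comp_hasFDerivAt z h2
  simp [partialD, h3.fderiv]

namespace IsGlobalC1Solution

variable {ρ : ℝ → ℝ → ℝ} {n₀ s₀ : Space → ℝ} {u₀ : Space → Space}
  {n s : Spacetime → ℝ} {u : Spacetime → Space}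

/-- Energy estimate on a slab of a backward cone on which the relative energy current is
timelike. -/
lemma eq_quiet_of_timelike (sol : IsGlobalC1Solution ρ n₀ s₀ u₀ n s u) (hρ : IsEquationOfState ρ)
    {N S c t₁ τ τ' : ℝ} {x₁ : Space} (hc : 0 < c) (hτ : 0 ≤ τ) (hτ' : τ' ≤ t₁)
    (hinit : ∀ x, ‖x - x₁‖ < c * (t₁ - τ) → n (τ, x) = N ∧ s (τ, x) = S ∧ u (τ, x) = 0)
    (hJ : ∀ z : Spacetime, τ ≤ z.1 → z.1 ≤ τ' → ‖z.2 - x₁‖ < c * (t₁ - z.1) →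
      0 ≤ relativeCurrent ρ N S (n z) (s z) (u z) 0 ∧
      (relativeCurrent ρ N S (n z) (s z) (u z) 0 = 0 → n z = N ∧ u z = 0) ∧
      ∀ y : Space, -(∑ i : Fin 3, y i * relativeCurrent ρ N S (n z) (s z) (u z) i.succ) ≤
        ‖y‖ * (c * relativeCurrent ρ N S (n z) (s z) (u z) 0))
    {t : ℝ} (ht : t ∈ Icc τ τ') {x : Space} (hx : ‖x - x₁‖ < c * (t₁ - t)) :
    n (t, x) = N ∧ u (t, x) = 0 := by
  set J : Fin 4 → Spacetime → ℝ := fun ν y => relativeCurrent ρ N S (n y) (s y) (u y) ν with hJdef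
  set φ := coneWeight c t₁ x₁ with hφ
  set F : Fin 4 → Spacetime → ℝ := fun ν y => φ y * J ν y with hF
  have hFC : ∀ ν, ContDiffOn ℝ 1 (F ν) Future := fun ν =>
    (contDiff_coneWeight c t₁ x₁).contDiffOn.mul (sol.contDiffOn_relativeCurrent N S ν)
  have hφ0 : ∀ z : Spacetime, z.1 ≤ t₁ → ¬ ‖z.2 - x₁‖ < c * (t₁ - z.1) → φ z = 0 := by
    intro z hz hn
    rw [← coneFun_pos_iff hc.le hz, not_lt] at hn
    exact expNegInvGlue.zero_of_nonpos hn
  have hsupp : ∀ ν, ∀ z : Spacetime, 0 ≤ z.1 → z.1 ≤ τ' → c * t₁ < ‖z.2 - x₁‖ → F ν z = 0 := by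
    intro ν z hz0 hz1 hz2
    have : φ z = 0 := hφ0 z (hz1.trans hτ') (not_lt.2 (by nlinarith))
    simp [hF, this]
  set e : ℝ → ℝ := fun t => ∫ x, F 0 (t, x) with he
  -- As J is conserved, e' = ∫ J^ν ∂_νφ. The gradient of φ is a nonnegative multiple of (-c²(t₁ -
  -- t), -(x - x₁)), and the timelike bound on J makes the contraction nonpositive inside the cone.
  have hanti : AntitoneOn e (Icc τ τ') := by
    have hder : ∀ t ∈ Ioo τ τ', HasDerivAt e (∫ x, ∑ ν, partialD ν (F ν) (t, x)) t := fun t ht =>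
      hasDerivAt_integral_slice hFC hsupp ⟨hτ.trans_lt ht.1, ht.2⟩
    refine antitoneOn_of_deriv_nonpos (convex_Icc τ τ')
      ((continuousOn_integral_slice (hFC 0).continuousOn (hsupp 0)).mono
        (Icc_subset_Icc_left hτ)) ?_ ?_
    · rw [interior_Icc]
      exact fun t ht => (hder t ht).differentiableAt.differentiableWithinAt
    · rw [interior_Icc]
      intro t ht
      rw [(hder t ht).deriv]
      refine integral_nonpos fun x => ?_
      have ht0 : 0 < t := hτ.trans_lt ht.1
      have htt : t ≤ t₁ := ht.2.le.trans hτ'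
      have hterm : ∀ ν, partialD ν (F ν) (t, x) =
          deriv expNegInvGlue (coneFun c t₁ x₁ (t, x)) *
            (partialD ν (coneFun c t₁ x₁) (t, x) * J ν (t, x)) +
          φ (t, x) * partialD ν (J ν) (t, x) := by
        intro ν
        simp only [hF]
        rw [partialD_mul ((contDiff_coneWeight c t₁ x₁).differentiable one_ne_zero _)
          (differentiableAt_of_future (sol.contDiffOn_relativeCurrent N S ν) ht0),
          partialD_coneWeight]
        ring
      simp only [hterm, Pi.zero_apply]
      rw [Finset.sum_add_distrib, ← Finset.mul_sum, ← Finset.mul_sum,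
        sol.relativeCurrent_conservation hρ N S (z := (t, x)) ht0, mul_zero, add_zero]
      by_cases hpos : 0 < coneFun c t₁ x₁ (t, x)
      · refine mul_nonpos_of_nonneg_of_nonpos expNegInvGlue.monotone.deriv_nonneg ?_
        rw [coneFun_pos_iff hc.le htt] at hpos
        simp only at hpos
        obtain ⟨h1, -, h3⟩ := hJ (t, x) ht.1.le ht.2.le hpos
        have h4 := h3 (x - x₁)
        have h5 : ‖x - x₁‖ * (c * J 0 (t, x)) ≤ c * (t₁ - t) * (c * J 0 (t, x)) :=
          mul_le_mul_of_nonneg_right hpos.le (mul_nonneg hc.le h1)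
        rw [Fin.sum_univ_succ, partialD_coneFun_zero]
        simp only [partialD_coneFun_succ]
        have h6 : ∑ i : Fin 3, -(2 * (x - x₁) i) * J i.succ (t, x) =
            2 * -(∑ i : Fin 3, (x - x₁) i * J i.succ (t, x)) := by
          rw [← Finset.sum_neg_distrib, Finset.mul_sum]
          exact Finset.sum_congr rfl fun i _ => by ring
        rw [h6]
        have h7 : -(∑ i : Fin 3, (x - x₁) i * J i.succ (t, x)) ≤ c * (t₁ - t) * (c * J 0 (t, x)) :=
          h4.trans h5
        linarith
      · rw [deriv_expNegInvGlue_of_nonpos (not_lt.1 hpos), zero_mul]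
  have heτ : e τ = 0 := by
    refine integral_eq_zero_of_ae (Eventually.of_forall fun x => ?_)
    simp only [hF, Pi.zero_apply]
    by_cases hx : ‖x - x₁‖ < c * (t₁ - τ)
    · obtain ⟨h1, h2, h3⟩ := hinit x hx
      have : J 0 (τ, x) = 0 := by
        simp only [hJdef]
        rw [h1, h2, h3, relativeCurrent_zero]
        simp [fourVel_zero]
      rw [this, mul_zero]
    · rw [hφ0 (τ, x) ((ht.1.trans ht.2).trans hτ') hx, zero_mul]
  have het : e t ≤ 0 := by
    rw [← heτ]
    exact hanti ⟨le_rfl, ht.1.trans ht.2⟩ ht ht.1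
  have ht0 : 0 ≤ t := hτ.trans ht.1
  -- A nonnegative continuous density with integral at most 0 vanishes, and the weight is positive
  -- inside the cone.
  have hF0 : F 0 (t, x) = 0 := by
    by_contra hne
    have hnn : 0 ≤ fun x => F 0 (t, x) := by
      intro y
      simp only [hF, Pi.zero_apply]
      by_cases hy : ‖y - x₁‖ < c * (t₁ - t)
      · exact mul_nonneg (expNegInvGlue.nonneg _) (hJ (t, y) ht.1 ht.2 hy).1
      · rw [hφ0 (t, y) (ht.2.trans hτ') hy, zero_mul]
    have hFc := continuous_slice (hFC 0).continuousOn ht0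
    have := hFc.integral_pos_of_hasCompactSupport_nonneg_nonzero
      (μ := volume) (hasCompactSupport_of_norm_sub fun y hy => hsupp 0 (t, y) ht0 ht.2 hy) hnn hne
    exact absurd het (not_le.2 this)
  have hφpos : 0 < φ (t, x) :=
    expNegInvGlue.pos_of_pos ((coneFun_pos_iff hc.le (ht.2.trans hτ')).2 hx)
  have hJ0 : J 0 (t, x) = 0 := by
    rcases mul_eq_zero.1 hF0 with h | h
    · exact absurd h hφpos.ne'
    · exact h
  exact (hJ (t, x) ht.1 ht.2 hx).2.1 hJ0

lemma adiabatic_neg (sol : IsGlobalC1Solution ρ n₀ s₀ u₀ n s u) (z : Spacetime) (hz : 0 < z.1) :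
    ∑ ν, fourVel (u z) ν * partialD ν (fun y => -s y) z = 0 := by
  have h := sol.adiabatic z hz
  rw [sum_mul_partialD] at h ⊢
  rw [fderiv_fun_neg]
  simpa using h

/-- Domain of dependence: data that are quiet on the base of a backward cone of slope larger than
the sound speed of the quiet state determine the state at its tip. -/
lemma eq_quiet_of_cone (sol : IsGlobalC1Solution ρ n₀ s₀ u₀ n s u) (hρ : IsEquationOfState ρ)
    {N S c t₁ : ℝ} {x₁ : Space} (hN : 0 < N) (hS : 0 ≤ S) (hc : soundSpeed ρ N S < c)
    (ht₁ : 0 ≤ t₁)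
    (hinit : ∀ x, ‖x - x₁‖ ≤ c * t₁ → n (0, x) = N ∧ s (0, x) = S ∧ u (0, x) = 0) :
    n (t₁, x₁) = N ∧ s (t₁, x₁) = S ∧ u (t₁, x₁) = 0 := by
  have hc0 : 0 < c := (hρ.soundSpeed_pos hN hS).trans hc
  set U : Spacetime → ℝ × ℝ × Space := fun z => (n z, s z, u z) with hU
  have hUc : ContinuousOn U Future :=
    sol.contDiff_n.continuousOn.prodMk (sol.contDiff_s.continuousOn.prodMk
      sol.contDiff_u.continuousOn)
  -- Times at which the open cone slice is quiet. Rescaling slices to the unit ball makes closedness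
  -- a condition for each fixed y; at τ = t₁ the slice is the tip alone.
  set A : Set ℝ := {τ | ∀ y ∈ Metric.ball (0 : Space) 1, U (τ, x₁ + (c * (t₁ - τ)) • y) = (N, S, 0)}
    with hA
  have hAclosed : IsClosed (A ∩ Icc 0 t₁) := by
    have : A ∩ Icc 0 t₁ = ⋂ y ∈ Metric.ball (0 : Space) 1,
        Icc 0 t₁ ∩ (fun τ => U (τ, x₁ + (c * (t₁ - τ)) • y)) ⁻¹' {(N, S, 0)} := by
      ext τ
      simp only [hA, mem_inter_iff, mem_ofPred_eq, mem_iInter, mem_preimage, mem_singleton_iff]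
      refine ⟨fun h y hy => ⟨h.2, h.1 y hy⟩, fun h => ⟨fun y hy => (h y hy).2, ?_⟩⟩
      exact (h 0 (by simp)).1
    rw [this]
    refine isClosed_biInter fun y _ => ?_
    refine ContinuousOn.preimage_isClosed_of_isClosed ?_ isClosed_Icc isClosed_singleton
    exact hUc.comp (by fun_prop) fun τ hτ => ⟨hτ.1, trivial⟩
  have hslice : ∀ τ, τ < t₁ → (τ ∈ A ↔
      ∀ x, ‖x - x₁‖ < c * (t₁ - τ) → U (τ, x) = (N, S, 0)) := by
    intro τ hτ
    have hr : 0 < c * (t₁ - τ) := mul_pos hc0 (by linarith)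
    constructor
    · intro h x hx
      have := h ((c * (t₁ - τ))⁻¹ • (x - x₁)) (by
        rw [mem_ball_zero_iff, norm_smul, norm_inv, Real.norm_of_nonneg hr.le,
          inv_mul_lt_iff₀ hr]
        simpa using hx)
      rwa [smul_smul, mul_inv_cancel₀ hr.ne', one_smul, add_sub_cancel] at this
    · intro h y hy
      refine h _ ?_
      rw [add_sub_cancel_left, norm_smul, Real.norm_of_nonneg hr.le]
      rw [mem_ball_zero_iff] at hy
      nlinarith
  have h0A : (0 : ℝ) ∈ A := by
    intro y hy
    rw [mem_ball_zero_iff] at hy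
    obtain ⟨h1, h2, h3⟩ := hinit (x₁ + (c * (t₁ - 0)) • y) (by
      rw [add_sub_cancel_left, norm_smul, sub_zero, Real.norm_of_nonneg (by positivity)]
      have : 0 ≤ c * t₁ := by positivity
      nlinarith)
    simp only [hU, h1, h2, h3]
  have hmem : t₁ ∈ A := by
    -- Continuation in time: A is closed and contains 0, so it suffices that each time in A before
    -- t₁ is followed by later ones in A.
    refine hAclosed.Icc_subset_of_forall_exists_gt h0A ?_ ⟨ht₁, le_rfl⟩
    rintro τ ⟨hτA, hτ0, hτ1⟩ b (hb : τ < b)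
    have hr : 0 < c * (t₁ - τ) := mul_pos hc0 (by linarith)
    have hclosed : ∀ x ∈ Metric.closedBall x₁ (c * (t₁ - τ)), U (τ, x) = (N, S, 0) := by
      have hEq : EqOn (fun x => U (τ, x)) (fun _ => (N, S, 0)) (Metric.ball x₁ (c * (t₁ - τ))) :=
        fun x hx => (hslice τ hτ1).1 hτA x (by simpa [dist_eq_norm] using hx)
      have := hEq.closure (continuous_slice hUc hτ0) continuous_const
      rwa [closure_ball x₁ hr.ne'] at this
    let good : ℝ × ℝ × Space → Prop := fun q => ‖q.2.2‖ ≤ c ∧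
        0 ≤ relativeCurrent ρ N S q.1 S q.2.2 0 ∧
        (relativeCurrent ρ N S q.1 S q.2.2 0 = 0 → q.1 = N ∧ q.2.2 = 0) ∧
        ∀ y : Space, -(∑ i : Fin 3, y i * relativeCurrent ρ N S q.1 S q.2.2 i.succ) ≤
          ‖y‖ * (c * relativeCurrent ρ N S q.1 S q.2.2 0)
    have hgood : ∀ᶠ q in 𝓝 (N, S, (0 : Space)), good q := by
      have h1 : Tendsto (fun q : ℝ × ℝ × Space => (q.1, q.2.2)) (𝓝 (N, S, 0)) (𝓝 (N, 0)) :=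
        (by fun_prop : Continuous fun q : ℝ × ℝ × Space => (q.1, q.2.2)).tendsto' _ _ rfl
      have h2 : ∀ᶠ q : ℝ × ℝ × Space in 𝓝 (N, S, 0), ‖q.2.2‖ < c :=
        (by fun_prop : Continuous fun q : ℝ × ℝ × Space => ‖q.2.2‖).continuousAt.eventually
          (Iio_mem_nhds (by simpa using hc0))
      filter_upwards [h1.eventually (eventually_relativeCurrent hρ hN hS hc), h2] with q h3 h4
        using ⟨h4.le, h3⟩
    -- The closed slice is compact and quiet, so nearness to the quiet state holds on it for a
    -- uniform time.
    have htube := (isCompact_closedBall x₁ (c * (t₁ - τ))).eventually_forall_of_forall_eventually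
      (x₀ := τ) (P := fun t x => 0 ≤ t → good (U (t, x))) (fun x hx => by
        have h1 := (hUc (τ, x) ⟨hτ0, trivial⟩).tendsto
        rw [hclosed x hx] at h1
        have h2 := eventually_nhdsWithin_iff.1 (h1.eventually hgood)
        filter_upwards [h2] with z hz hz0 using hz ⟨hz0, trivial⟩)
    obtain ⟨δ, hδ, hball⟩ := Metric.eventually_nhds_iff_ball.1 htube
    set τ' := min (min b t₁) (τ + δ / 2) with hτ'
    have hττ' : τ < τ' := lt_min (lt_min hb hτ1) (by linarith)
    have hτ'b : τ' ≤ b := (min_le_left _ _).trans (min_le_left _ _)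
    have hτ't : τ' ≤ t₁ := (min_le_left _ _).trans (min_le_right _ _)
    have hτ'δ : τ' ≤ τ + δ / 2 := min_le_right _ _
    have hprop : ∀ z : Spacetime, τ ≤ z.1 → z.1 ≤ τ' → ‖z.2 - x₁‖ ≤ c * (t₁ - z.1) →
        good (U z) :=
      fun z hz1 hz2 hz3 => hball z.1 (by
        rw [Metric.mem_ball, Real.dist_eq, abs_lt]; constructor <;> linarith) z.2 (by
        rw [Metric.mem_closedBall, dist_eq_norm]
        refine hz3.trans ?_
        gcongr) (hτ0.trans hz1)
    -- Entropy comes first, because the current is known to be timelike only for s = S. Transport is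
    -- applied to s and to -s on subcones.
    have hs : ∀ z : Spacetime, τ ≤ z.1 → z.1 ≤ τ' → ‖z.2 - x₁‖ ≤ c * (t₁ - z.1) → s z = S := by
      rintro ⟨t, x⟩ hz1 hz2 hz3
      simp only at hz1 hz2 hz3
      have hsub : ∀ (t' : ℝ) (y : Space), t' ≤ t → ‖y - x‖ ≤ c * (t - t') →
          ‖y - x₁‖ ≤ c * (t₁ - t') := by
        intro t' y _ hy
        have := norm_sub_le_norm_sub_add_norm_sub y x x₁
        linarith
      have hspeed : ∀ z : Spacetime, τ ≤ z.1 → z.1 ≤ t → ‖z.2 - x‖ ≤ c * (t - z.1) →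
          ‖u z‖ ≤ c * fourVel (u z) 0 := by
        intro z h1 h2 h3
        have h4 : ‖u z‖ ≤ c := (hprop z h1 (h2.trans hz2) (hsub z.1 z.2 h2 h3)).1
        have := one_le_fourVel_zero (u z)
        nlinarith
      have hbase : ∀ y, ‖y - x‖ ≤ c * (t - τ) → s (τ, y) = S := by
        intro y hy
        have := hclosed y (by
          rw [Metric.mem_closedBall, dist_eq_norm]
          exact hsub τ y hz1 hy)
        exact (Prod.ext_iff.1 (Prod.ext_iff.1 this).2).1
      have h1 := le_of_transport sol.contDiff_s sol.adiabatic hτ0 hz1 hspeed (m := S)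
        fun y hy => (hbase y hy).ge
      have h2 := le_of_transport sol.contDiff_s.neg sol.adiabatic_neg hτ0 hz1 hspeed (m := -S)
        fun y hy => by simp [hbase y hy]
      exact le_antisymm (by simpa using h2) h1
    refine ⟨τ', ?_, hττ', hτ'b⟩
    have hstate : ∀ t ∈ Icc τ τ', ∀ x, ‖x - x₁‖ < c * (t₁ - t) → U (t, x) = (N, S, 0) := by
      intro t ht x hx
      have h1 := sol.eq_quiet_of_timelike hρ hc0 hτ0 hτ't (N := N) (S := S) (x₁ := x₁)
        (fun x hx => by
          have := (hslice τ hτ1).1 hτA x hx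
          simpa [hU] using this)
        (fun z h1 h2 h3 => by
          rw [hs z h1 h2 h3.le]
          exact (hprop z h1 h2 h3.le).2) ht hx
      simp [hU, h1.1, h1.2, hs (t, x) ht.1 ht.2 hx.le]
    -- If τ' = t₁, the slice is the tip, where the state is the limit along the axis of the cone.
    rcases hτ't.eq_or_lt with h | h
    · intro y _
      have hlim : ContinuousWithinAt (fun t => U (t, x₁)) (Ioo τ τ') τ' :=
        ((hUc.comp (f := fun t : ℝ => (t, x₁)) (s := Ici 0) (by fun_prop)
          fun t ht => ⟨ht, trivial⟩) τ' (hτ0.trans hττ'.le)).mono fun t ht => hτ0.trans ht.1.le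
      have hne : (𝓝[Ioo τ τ'] τ').NeBot := by
        rw [← mem_closure_iff_nhdsWithin_neBot, closure_Ioo hττ'.ne]
        exact ⟨hττ'.le, le_rfl⟩
      have hconst : Tendsto (fun t => U (t, x₁)) (𝓝[Ioo τ τ'] τ') (𝓝 (N, S, 0)) := by
        refine tendsto_const_nhds.congr' ?_
        filter_upwards [self_mem_nhdsWithin] with t ht
        refine (hstate t ⟨ht.1.le, ht.2.le⟩ x₁ ?_).symm
        rw [sub_self, norm_zero]
        exact mul_pos hc0 (by linarith [ht.2])
      have := tendsto_nhds_unique hlim.tendsto hconst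
      rw [h, sub_self, mul_zero, zero_smul, add_zero, ← h]
      exact this
    · exact (hslice τ' h).2 (hstate τ' ⟨hττ'.le, le_rfl⟩)
  have := hmem 0 (by simp)
  simpa [hU] using this

/-- Finite speed of propagation: outside the sound cone of the quiet state the solution is
undisturbed. -/
lemma eq_quiet_of_lt_norm (sol : IsGlobalC1Solution ρ n₀ s₀ u₀ n s u) (hρ : IsEquationOfState ρ)
    {R₀ N S : ℝ} (hdata : IsQuietPerturbation R₀ N S n₀ s₀ u₀) {t : ℝ} (ht : 0 ≤ t) {x : Space}
    (hx : R₀ + soundSpeed ρ N S * t < ‖x‖) :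
    n (t, x) = N ∧ s (t, x) = S ∧ u (t, x) = 0 := by
  obtain ⟨c, hc1, hc2⟩ : ∃ c, soundSpeed ρ N S < c ∧ R₀ + c * t < ‖x‖ := by
    have h1 : ∀ᶠ c in 𝓝[>] (soundSpeed ρ N S), R₀ + c * t < ‖x‖ :=
      ((by fun_prop : Continuous fun c : ℝ => R₀ + c * t).continuousAt.eventually
        (Iio_mem_nhds hx)).filter_mono nhdsWithin_le_nhds
    obtain ⟨c, h2, h3⟩ := (h1.and self_mem_nhdsWithin).exists
    exact ⟨c, h3, h2⟩
  refine sol.eq_quiet_of_cone hρ hdata.nbar_pos hdata.sbar_pos.le hc1 ht fun y hy => ?_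
  have hy' : R₀ < ‖y‖ := by
    have h1 := norm_sub_norm_le x y
    rw [norm_sub_rev] at h1
    linarith
  rw [sol.init_n, sol.init_s, sol.init_u]
  exact ⟨hdata.n₀_eq y hy', hdata.s₀_eq y hy', hdata.u₀_eq y hy'⟩

/-- The entropy never falls below its initial lower bound. -/
lemma le_entropy (sol : IsGlobalC1Solution ρ n₀ s₀ u₀ n s u) {S : ℝ} (hS : ∀ x, S ≤ s₀ x)
    {z : Spacetime} (hz : 0 ≤ z.1) : S ≤ s z :=
  -- Slope 1 serves for every state, since |u| ≤ u⁰.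
  le_of_transport (c := 1) (τ := 0) (t := z.1) (x := z.2) sol.contDiff_s sol.adiabatic le_rfl hz
    (fun w _ _ _ => by simpa using norm_le_fourVel_zero (u w)) fun y _ => by
      rw [sol.init_s]; exact hS y

end IsGlobalC1Solution

/-! ### The Riccati inequality. -/

/-- A positive global solution of the Riccati inequality `Q' ≥ k g(R₀ + η t) Q²` forces a bound on
its initial value. -/
lemma integral_le_of_riccati {Q Q' g : ℝ → ℝ} {k η R₀ : ℝ} (hR₀ : 0 < R₀) (hη : 0 < η) (hk : 0 ≤ k)
    (hgc : ContinuousOn g (Ioi 0)) (hg0 : ∀ r, 0 < r → 0 ≤ g r)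
    (hgi : IntegrableOn g (Ioi R₀)) (hQc : ∀ T, ContinuousOn Q (Icc 0 T))
    (hQ' : ∀ t, 0 < t → HasDerivAt Q (Q' t) t)
    (hineq : ∀ t, 0 < t → k * g (R₀ + η * t) * Q t ^ 2 ≤ Q' t) (hQ0 : 0 < Q 0) :
    k * ∫ r in Ioi R₀, g r ≤ η / Q 0 := by
  have hpos : ∀ t, 0 ≤ t → 0 < R₀ + η * t := fun t ht => by positivity
  have hQpos : ∀ t, 0 ≤ t → 0 < Q t := by
    intro t ht
    have hmono : MonotoneOn Q (Icc 0 t) := by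
      refine monotoneOn_of_deriv_nonneg (convex_Icc 0 t) (hQc t) ?_ ?_ <;> rw [interior_Icc]
      · exact fun τ hτ => (hQ' τ hτ.1).differentiableAt.differentiableWithinAt
      · intro τ hτ
        rw [(hQ' τ hτ.1).deriv]
        refine le_trans ?_ (hineq τ hτ.1)
        have := hg0 _ (hpos τ hτ.1.le)
        positivity
    exact hQ0.trans_le (hmono ⟨le_rfl, ht⟩ ⟨ht, le_rfl⟩ ht)
  have hΦ : ∀ r, 0 < r → HasDerivAt (fun r => ∫ y in R₀..r, g y) (g r) r := by
    intro r hr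
    have hsub : uIcc R₀ r ⊆ Ioi 0 := fun y hy => (lt_min hR₀ hr).trans_le hy.1
    exact intervalIntegral.integral_hasDerivAt_right (hgc.mono hsub).intervalIntegrable
      (hgc.stronglyMeasurableAtFilter isOpen_Ioi r hr) (hgc.continuousAt (Ioi_mem_nhds hr))
  have hbound : ∀ T, 0 ≤ T → k * ∫ y in R₀..(R₀ + η * T), g y ≤ η / Q 0 := by
    intro T hT
    -- f' = η(Q'/Q² - k g(R₀ + ηt)) ≥ 0; comparing f at 0 and T and dropping η/Q(T) ≥ 0 gives the
    -- bound.
    set f : ℝ → ℝ := fun t => -(η * (Q t)⁻¹) - k * ∫ y in R₀..(R₀ + η * t), g y with hf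
    have hΦt : ∀ t, 0 ≤ t → HasDerivAt (fun t => ∫ y in R₀..(R₀ + η * t), g y)
        (g (R₀ + η * t) * η) t := fun t ht =>
      HasDerivAt.comp (h₂ := fun r => ∫ y in R₀..r, g y) (h := fun t => R₀ + η * t) t
        (hΦ _ (hpos t ht)) (by simpa using ((hasDerivAt_id t).const_mul η).const_add R₀)
    have hd : ∀ t, 0 < t → HasDerivAt f
        (-(η * (-(Q' t) / Q t ^ 2)) - k * (g (R₀ + η * t) * η)) t := fun t ht =>
      ((((hQ' t ht).inv (hQpos t ht.le).ne').const_mul η).neg).sub ((hΦt t ht.le).const_mul k)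
    have hmono : MonotoneOn f (Icc 0 T) := by
      refine monotoneOn_of_deriv_nonneg (convex_Icc 0 T) ?_ ?_ ?_
      · refine ContinuousOn.sub (ContinuousOn.neg (continuousOn_const.mul
          ((hQc T).inv₀ fun t ht => (hQpos t ht.1).ne'))) (continuousOn_const.mul ?_)
        exact fun t ht => (hΦt t ht.1).continuousAt.continuousWithinAt
      · rw [interior_Icc]
        exact fun τ hτ => (hd τ hτ.1).differentiableAt.differentiableWithinAt
      · rw [interior_Icc]
        intro t ht
        rw [(hd t ht.1).deriv]
        have h1 : k * g (R₀ + η * t) ≤ Q' t / Q t ^ 2 := by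
          rw [le_div_iff₀ (by have := hQpos t ht.1.le; positivity)]
          exact hineq t ht.1
        have h2 : -(η * (-(Q' t) / Q t ^ 2)) - k * (g (R₀ + η * t) * η) =
            η * (Q' t / Q t ^ 2 - k * g (R₀ + η * t)) := by ring
        rw [h2]
        exact mul_nonneg hη.le (by linarith)
    have h1 := hmono ⟨le_rfl, hT⟩ ⟨hT, le_rfl⟩ hT
    simp only [hf, mul_zero, add_zero, intervalIntegral.integral_same, sub_zero] at h1
    have h2 : 0 ≤ η * (Q T)⁻¹ := by
      have := hQpos T hT
      positivity
    rw [div_eq_mul_inv]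
    linarith
  have hlim : Tendsto (fun T => R₀ + η * T) atTop atTop :=
    tendsto_atTop_add_const_left _ _ (tendsto_id.const_mul_atTop hη)
  refine le_of_tendsto ((intervalIntegral_tendsto_integral_Ioi R₀ hgi hlim).const_mul k) ?_
  filter_upwards [eventually_ge_atTop 0] with T hT using hbound T hT

/-! ### Energy conservation, the virial identity and the inequality for Q. -/

lemma energyTensor_symm (ρ : ℝ → ℝ → ℝ) (n s : ℝ) (v : Space) (μ ν : Fin 4) :
    energyTensor ρ n s v μ ν = energyTensor ρ n s v ν μ := by
  simp only [energyTensor, minkowski]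
  rcases eq_or_ne μ ν with rfl | h
  · rfl
  · rw [if_neg h, if_neg h.symm]; ring

lemma energyTensor_zero_zero (ρ : ℝ → ℝ → ℝ) (n s : ℝ) (v : Space) :
    energyTensor ρ n s v 0 0 = ρ n s + (ρ n s + pressure ρ n s) * ‖v‖ ^ 2 := by
  have := fourVel_zero_sq v
  simp only [energyTensor, minkowski, if_true]
  linear_combination (ρ n s + pressure ρ n s) * this

lemma energyTensor_zero_succ (ρ : ℝ → ℝ → ℝ) (n s : ℝ) (v : Space) (i : Fin 3) :
    energyTensor ρ n s v 0 i.succ = (ρ n s + pressure ρ n s) * fourVel v 0 * v i := by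
  have : (0 : Fin 4) ≠ i.succ := (Fin.succ_ne_zero i).symm
  simp [energyTensor, minkowski, this, fourVel_succ]

lemma energyTensor_quiet_succ (ρ : ℝ → ℝ → ℝ) (n s : ℝ) (i : Fin 3) (ν : Fin 4) :
    energyTensor ρ n s 0 i.succ ν = pressure ρ n s * minkowski i.succ ν := by
  simp [energyTensor, fourVel_succ]

lemma norm_sq_eq_sum (v : Space) : ‖v‖ ^ 2 = ∑ i : Fin 3, v i * v i := by
  rw [EuclideanSpace.norm_sq_eq]
  exact Finset.sum_congr rfl fun i _ => by rw [Real.norm_eq_abs, sq_abs, sq]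

lemma sum_energyTensor_sub (ρ : ℝ → ℝ → ℝ) (n s : ℝ) (v : Space) (P : ℝ) :
    ∑ i : Fin 3, (energyTensor ρ n s v i.succ i.succ - P) =
      (ρ n s + pressure ρ n s) * ‖v‖ ^ 2 + 3 * (pressure ρ n s - P) := by
  rw [norm_sq_eq_sum]
  simp only [energyTensor, minkowski, fourVel_succ, if_true, Fin.succ_ne_zero, if_false,
    Fin.sum_univ_three]
  ring

lemma partialD_coord (i : Fin 3) (ν : Fin 4) (z : Spacetime) :
    partialD ν (fun y : Spacetime => y.2 i) z = if ν = i.succ then 1 else 0 := by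
  have h : HasFDerivAt (fun y : Spacetime => y.2 i)
      ((EuclideanSpace.proj i : Space →L[ℝ] ℝ).comp (ContinuousLinearMap.snd ℝ ℝ Space)) z :=
    ((EuclideanSpace.proj i : Space →L[ℝ] ℝ).comp (ContinuousLinearMap.snd ℝ ℝ Space)).hasFDerivAt
  rw [partialD, h.fderiv]
  refine Fin.cases ?_ (fun j => ?_) ν
  · simp [coordVec_zero, (Fin.succ_ne_zero i).symm]
  · by_cases hij : j = i
    · simp [coordVec_succ, hij]
    · simp [coordVec_succ, hij, Ne.symm hij]

lemma contDiff_coord (i : Fin 3) : ContDiff ℝ 1 fun y : Spacetime => y.2 i :=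
  ((EuclideanSpace.proj i : Space →L[ℝ] ℝ).comp (ContinuousLinearMap.snd ℝ ℝ Space)).contDiff

namespace IsGlobalC1Solution

variable {ρ : ℝ → ℝ → ℝ} {n₀ s₀ : Space → ℝ} {u₀ : Space → Space}
  {n s : Spacetime → ℝ} {u : Spacetime → Space}

/-- Conservation of the total energy of the perturbation. -/
lemma integral_energy (sol : IsGlobalC1Solution ρ n₀ s₀ u₀ n s u) (hρ : IsEquationOfState ρ)
    {R₀ N S : ℝ} (hdata : IsQuietPerturbation R₀ N S n₀ s₀ u₀) {t : ℝ} (ht : 0 ≤ t) :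
    ∫ x, (energyTensor ρ (n (t, x)) (s (t, x)) (u (t, x)) 0 0 - ρ N S) =
      perturbationEnergy ρ N S n₀ s₀ u₀ := by
  -- Subtracting the constant quiet tensor keeps the current divergence-free and makes it spatially
  -- compactly supported.
  set F : Fin 4 → Spacetime → ℝ := fun ν z =>
    energyTensor ρ (n z) (s z) (u z) 0 ν - energyTensor ρ N S 0 0 ν with hF
  have hF0 : ∀ z, energyTensor ρ (n z) (s z) (u z) 0 0 - ρ N S = F 0 z := fun z => by
    simp [hF, energyTensor_zero_zero ρ N S]
  have hinit : perturbationEnergy ρ N S n₀ s₀ u₀ = ∫ x, F 0 (0, x) := by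
    simp only [perturbationEnergy, hF, sol.init_n, sol.init_s, sol.init_u]
  simp only [hF0]
  rw [hinit]
  rcases ht.eq_or_lt with rfl | ht
  · rfl
  have hFC : ∀ ν, ContDiffOn ℝ 1 (F ν) Future := fun ν =>
    (sol.contDiffOn_energyTensor 0 ν).sub contDiffOn_const
  have hη := hρ.soundSpeed_pos hdata.nbar_pos hdata.sbar_pos.le
  have hsupp : ∀ ν, ∀ z : Spacetime, 0 ≤ z.1 → z.1 ≤ t →
      R₀ + soundSpeed ρ N S * t < ‖z.2 - 0‖ → F ν z = 0 := by
    intro ν z h1 h2 h3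
    obtain ⟨e1, e2, e3⟩ := sol.eq_quiet_of_lt_norm hρ hdata h1 (x := z.2) (by
      rw [sub_zero] at h3; nlinarith)
    simp [hF, e1, e2, e3]
  obtain ⟨τ, hτ, h⟩ := exists_hasDerivAt_eq_slope (fun t => ∫ x, F 0 (t, x))
    (fun t => ∫ x, ∑ ν, partialD ν (F ν) (t, x)) ht
    (continuousOn_integral_slice (hFC 0).continuousOn (hsupp 0))
    fun τ hτ => hasDerivAt_integral_slice hFC hsupp hτ
  have hz : ∀ x, ∑ ν, partialD ν (F ν) (τ, x) = 0 := by
    intro x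
    rw [← sol.conservation hρ (z := (τ, x)) hτ.1 0]
    refine Finset.sum_congr rfl fun ν _ => ?_
    simp only [hF]
    rw [partialD_sub (differentiableAt_of_future (sol.contDiffOn_energyTensor 0 ν) hτ.1)
      (differentiableAt_const _), partialD_const, sub_zero]
  simp only [hz, integral_zero, sub_zero] at h
  rw [eq_div_iff ht.ne'] at h
  linarith

/-- The virial identity for the radial momentum. -/
lemma hasDerivAt_radialMomentum (sol : IsGlobalC1Solution ρ n₀ s₀ u₀ n s u)
    (hρ : IsEquationOfState ρ) {R₀ N S : ℝ} (hdata : IsQuietPerturbation R₀ N S n₀ s₀ u₀) (T : ℝ) :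
    ContinuousOn (fun t => radialMomentum ρ (fun x => n (t, x)) (fun x => s (t, x))
      fun x => u (t, x)) (Icc 0 T) ∧
    ∀ t ∈ Ioo 0 T, HasDerivAt (fun t => radialMomentum ρ (fun x => n (t, x)) (fun x => s (t, x))
      fun x => u (t, x)) (∫ x, ((ρ (n (t, x)) (s (t, x)) + pressure ρ (n (t, x)) (s (t, x))) *
        ‖u (t, x)‖ ^ 2 + 3 * (pressure ρ (n (t, x)) (s (t, x)) - pressure ρ N S))) t := by
  -- Subtracting p̄g^{iν} gives compact support without altering the component ν = 0, so Q is
  -- unchanged.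
  set G : Fin 3 → Fin 4 → Spacetime → ℝ := fun i ν z =>
    energyTensor ρ (n z) (s z) (u z) i.succ ν - pressure ρ N S * minkowski i.succ ν with hG
  set F : Fin 4 → Spacetime → ℝ := fun ν z => ∑ i : Fin 3, z.2 i * G i ν z with hF
  have hQ : (fun t => radialMomentum ρ (fun x => n (t, x)) (fun x => s (t, x))
      fun x => u (t, x)) = fun t => ∫ x, F 0 (t, x) := by
    ext t
    simp only [radialMomentum, hF, hG]
    refine integral_congr_ae (Eventually.of_forall fun x => Finset.sum_congr rfl fun i _ => ?_)
    rw [energyTensor_symm]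
    simp [minkowski]
  have hGC : ∀ i ν, ContDiffOn ℝ 1 (G i ν) Future := fun i ν =>
    (sol.contDiffOn_energyTensor i.succ ν).sub contDiffOn_const
  have hFC : ∀ ν, ContDiffOn ℝ 1 (F ν) Future := fun ν =>
    ContDiffOn.sum fun i _ => (contDiff_coord i).contDiffOn.mul (hGC i ν)
  have hη := hρ.soundSpeed_pos hdata.nbar_pos hdata.sbar_pos.le
  have hsupp : ∀ ν, ∀ z : Spacetime, 0 ≤ z.1 → z.1 ≤ T →
      R₀ + soundSpeed ρ N S * T < ‖z.2 - 0‖ → F ν z = 0 := by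
    intro ν z h1 h2 h3
    obtain ⟨e1, e2, e3⟩ := sol.eq_quiet_of_lt_norm hρ hdata h1 (x := z.2) (by
      rw [sub_zero] at h3; nlinarith)
    simp [hF, hG, e1, e2, e3, energyTensor_quiet_succ]
  rw [hQ]
  refine ⟨continuousOn_integral_slice (hFC 0).continuousOn (hsupp 0), fun t ht => ?_⟩
  refine (hasDerivAt_integral_slice hFC hsupp ht).congr_deriv ?_
  refine integral_congr_ae (Eventually.of_forall fun x => ?_)
  simp only
  rw [← sum_energyTensor_sub]
  have hdG : ∀ i ν, DifferentiableAt ℝ (G i ν) (t, x) := fun i ν =>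
    differentiableAt_of_future (hGC i ν) ht.1
  have hdx : ∀ i : Fin 3, DifferentiableAt ℝ (fun y : Spacetime => y.2 i) (t, x) := fun i =>
    (contDiff_coord i).differentiable one_ne_zero _
  have hterm : ∀ ν, partialD ν (F ν) (t, x) =
      ∑ i : Fin 3, ((if ν = i.succ then 1 else 0) * G i ν (t, x) +
        x i * partialD ν (fun y => energyTensor ρ (n y) (s y) (u y) i.succ ν) (t, x)) := by
    intro ν
    have h1 : partialD ν (F ν) (t, x) =
        ∑ i : Fin 3, partialD ν (fun y : Spacetime => y.2 i * G i ν y) (t, x) := by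
      simp only [partialD, hF]
      rw [fderiv_fun_sum fun i _ => (hdx i).fun_mul (hdG i ν)]
      simp
    rw [h1]
    refine Finset.sum_congr rfl fun i _ => ?_
    rw [partialD_mul (hdx i) (hdG i ν), partialD_coord]
    simp only [hG]
    rw [partialD_sub (differentiableAt_of_future (sol.contDiffOn_energyTensor i.succ ν) ht.1)
      (differentiableAt_const _), partialD_const, sub_zero]
  simp only [hterm]
  -- Momentum conservation removes the terms with xⁱ; those from ∂_ν xⁱ leave the trace of the
  -- stress perturbation.
  rw [Finset.sum_comm]
  refine Finset.sum_congr rfl fun i _ => ?_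
  rw [Finset.sum_add_distrib, ← Finset.mul_sum, sol.conservation hρ (z := (t, x)) ht.1 i.succ,
    mul_zero, add_zero]
  simp [hG, minkowski]

/-- The differential inequality for the radial momentum. -/
lemma radialMomentum_sq_le (sol : IsGlobalC1Solution ρ n₀ s₀ u₀ n s u)
    (hρ : IsEquationOfState ρ) (hA1 : RhoAntitoneInEntropy ρ) (hA2 : SoundSpeedMonotoneInPressure ρ)
    {R₀ N S : ℝ} (hdata : IsQuietPerturbation R₀ N S n₀ s₀ u₀) (hη : soundSpeed ρ N S < 1 / 3)
    (hE : 0 < perturbationEnergy ρ N S n₀ s₀ u₀) (hs₀ : ∀ x, S ≤ s₀ x) {t r : ℝ} (ht : 0 < t)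
    (hr : r = R₀ + soundSpeed ρ N S * t) :
    (1 - 3 * soundSpeed ρ N S ^ 2) / 2 *
        (1 / (perturbationEnergy ρ N S n₀ s₀ u₀ * r ^ 2 + 4 * Real.pi / 3 * ρ N S * r ^ 5)) *
        radialMomentum ρ (fun x => n (t, x)) (fun x => s (t, x)) (fun x => u (t, x)) ^ 2 ≤
      ∫ x, ((ρ (n (t, x)) (s (t, x)) + pressure ρ (n (t, x)) (s (t, x))) *
        ‖u (t, x)‖ ^ 2 + 3 * (pressure ρ (n (t, x)) (s (t, x)) - pressure ρ N S)) := by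
  have hη0 := hρ.soundSpeed_pos hdata.nbar_pos hdata.sbar_pos.le
  set η := soundSpeed ρ N S with hηdef
  set E := perturbationEnergy ρ N S n₀ s₀ u₀ with hEdef
  set Q := radialMomentum ρ (fun x => n (t, x)) (fun x => s (t, x)) (fun x => u (t, x)) with hQdef
  have hR₀ := hdata.R₀_pos
  have hr0 : 0 < r := by rw [hr]; positivity
  have hρ0 : 0 ≤ ρ N S := hρ.rho_nonneg N S hdata.nbar_pos.le hdata.sbar_pos.le
  have hquiet : ∀ x : Space, r < ‖x‖ → n (t, x) = N ∧ s (t, x) = S ∧ u (t, x) = 0 := fun x hx =>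
    sol.eq_quiet_of_lt_norm hρ hdata ht.le (hr ▸ hx)
  set H : Space → ℝ := fun x => ρ (n (t, x)) (s (t, x)) + pressure ρ (n (t, x)) (s (t, x)) with hH
  have hcρ : Continuous fun x => ρ (n (t, x)) (s (t, x)) :=
    continuous_slice sol.contDiff_rho.continuousOn ht.le
  have hcp : Continuous fun x => pressure ρ (n (t, x)) (s (t, x)) :=
    continuous_slice sol.contDiff_pressure.continuousOn ht.le
  have hcu : Continuous fun x => u (t, x) := continuous_slice sol.contDiff_u.continuousOn ht.le
  have hcH : Continuous H := hcρ.add hcp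
  have hint : ∀ f : Space → ℝ, Continuous f → (∀ x, r < ‖x‖ → f x = 0) → Integrable f :=
    fun f hf hf0 => hf.integrable_of_hasCompactSupport
      (hasCompactSupport_of_norm_sub (x₁ := 0) (R := r) fun x hx => hf0 x (by simpa using hx))
  have hK : Integrable fun x => H x * ‖u (t, x)‖ ^ 2 :=
    hint _ (hcH.mul (hcu.norm.pow 2)) fun x hx => by simp [(hquiet x hx).2.2]
  have hP : Integrable fun x => 3 * (pressure ρ (n (t, x)) (s (t, x)) - pressure ρ N S) :=
    hint _ (continuous_const.mul (hcp.sub continuous_const)) fun x hx => by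
      obtain ⟨e1, e2, -⟩ := hquiet x hx
      simp [e1, e2]
  have hT : Integrable fun x =>
      energyTensor ρ (n (t, x)) (s (t, x)) (u (t, x)) 0 0 - ρ N S := by
    refine hint _ ((continuous_slice (sol.contDiffOn_energyTensor 0 0).continuousOn ht.le).sub
      continuous_const) fun x hx => ?_
    obtain ⟨e1, e2, e3⟩ := hquiet x hx
    simp [e1, e2, e3, energyTensor_zero_zero]
  have hM : Integrable fun x => ∑ i : Fin 3, x i *
      energyTensor ρ (n (t, x)) (s (t, x)) (u (t, x)) 0 i.succ := by
    refine hint _ (continuous_finsetSum _ fun i _ => Continuous.mul (by fun_prop)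
      (continuous_slice (sol.contDiffOn_energyTensor 0 i.succ).continuousOn ht.le)) fun x hx => ?_
    simp [energyTensor_zero_succ, (hquiet x hx).2.2]
  -- Adding ρ̄ on the ball to T⁰⁰ - ρ̄ yields the total energy E + (4π/3)ρ̄r³ in the ball.
  have hB : Integrable ((Metric.closedBall (0 : Space) r).indicator fun _ => ρ N S) :=
    (integrable_indicator_iff measurableSet_closedBall).2
      (integrableOn_const (isCompact_closedBall _ _).measure_lt_top.ne)
  have hBval : ∫ x, (Metric.closedBall (0 : Space) r).indicator (fun _ => ρ N S) x =
      4 * Real.pi / 3 * ρ N S * r ^ 3 := by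
    rw [integral_indicator measurableSet_closedBall, setIntegral_const, Measure.real,
      EuclideanSpace.volume_closedBall_fin_three, ENNReal.toReal_mul, ENNReal.toReal_pow,
      ENNReal.toReal_ofReal hr0.le, ENNReal.toReal_ofReal (by positivity), smul_eq_mul]
    ring
  have hEval : ∫ x, (energyTensor ρ (n (t, x)) (s (t, x)) (u (t, x)) 0 0 - ρ N S) = E :=
    sol.integral_energy hρ hdata ht.le
  set K := ∫ x, H x * ‖u (t, x)‖ ^ 2 with hKdef
  have hH0 : ∀ x, 0 ≤ H x := fun x => add_nonneg
    (hρ.rho_nonneg _ _ (sol.n_nonneg _ ht.le) (sol.s_nonneg _ ht.le))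
    (hρ.pressure_nonneg _ _ (sol.n_nonneg _ ht.le) (sol.s_nonneg _ ht.le))
  have hk : 0 < 1 - 3 * η ^ 2 := by nlinarith
  have hlower : (1 - 3 * η ^ 2) * K ≤
      ∫ x, (H x * ‖u (t, x)‖ ^ 2 + 3 * (pressure ρ (n (t, x)) (s (t, x)) - pressure ρ N S)) := by
    have h1 : (1 - 3 * η ^ 2) * K + 3 * η ^ 2 * E =
        ∫ x, ((1 - 3 * η ^ 2) * (H x * ‖u (t, x)‖ ^ 2) + 3 * η ^ 2 *
          (energyTensor ρ (n (t, x)) (s (t, x)) (u (t, x)) 0 0 - ρ N S)) := by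
      rw [integral_add (hK.const_mul _) (hT.const_mul _), integral_const_mul, integral_const_mul,
        hEval]
    have h2 : (1 - 3 * η ^ 2) * K + 3 * η ^ 2 * E ≤
        ∫ x, (H x * ‖u (t, x)‖ ^ 2 +
          3 * (pressure ρ (n (t, x)) (s (t, x)) - pressure ρ N S)) := by
      rw [h1]
      refine integral_mono ((hK.const_mul _).add (hT.const_mul _)) (hK.add hP) fun x => ?_
      have h3 := hρ.soundSpeed_sq_mul_rho_sub_le hA1 hA2 hdata.nbar_pos hdata.sbar_pos.le
        (sol.n_nonneg (t, x) ht.le) (sol.le_entropy hs₀ (z := (t, x)) ht.le)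
      simp only [energyTensor_zero_zero, hH]
      rw [← hηdef] at h3
      linarith
    have h3 : 0 ≤ 3 * η ^ 2 * E := by positivity
    linarith
  set M := 2 * r ^ 2 * (E + 4 * Real.pi / 3 * ρ N S * r ^ 3) with hMdef
  have hMpos : 0 < M := by positivity
  -- Cauchy–Schwarz in quadratic form, from |lu⁰x - u|² ≥ 0 weighted by ρ + p; the optimal l = Q/M
  -- is inserted below.
  have hquad : ∀ l : ℝ, 2 * l * Q ≤ l ^ 2 * M + K := by
    intro l
    have h1 : l ^ 2 * M + K = ∫ x, (2 * l ^ 2 * r ^ 2 *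
        ((energyTensor ρ (n (t, x)) (s (t, x)) (u (t, x)) 0 0 - ρ N S) +
          (Metric.closedBall (0 : Space) r).indicator (fun _ => ρ N S) x) +
        H x * ‖u (t, x)‖ ^ 2) := by
      have hTB : Integrable fun x =>
          (energyTensor ρ (n (t, x)) (s (t, x)) (u (t, x)) 0 0 - ρ N S) +
            (Metric.closedBall (0 : Space) r).indicator (fun _ => ρ N S) x := hT.add hB
      rw [integral_add (hTB.const_mul _) hK, integral_const_mul, integral_add hT hB, hEval,
        hBval, hMdef]
      ring
    rw [h1, hQdef, radialMomentum, ← integral_const_mul]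
    refine integral_mono (hM.const_mul _) (((hT.add hB).const_mul _).add hK) fun x => ?_
    simp only [energyTensor_zero_succ, energyTensor_zero_zero]
    by_cases hx : r < ‖x‖
    · obtain ⟨e1, e2, e3⟩ := hquiet x hx
      rw [indicator_of_notMem (by simpa using hx)]
      simp [e1, e2, e3]
    · rw [not_lt] at hx
      rw [indicator_of_mem (by simpa using hx)]
      set v := u (t, x) with hv
      set γ := fourVel v 0 with hγ
      have hγ2 : γ ^ 2 = 1 + ‖v‖ ^ 2 := fourVel_zero_sq v
      have hγ0 : 0 ≤ γ := zero_le_one.trans (one_le_fourVel_zero v)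
      have hsum : ∑ i : Fin 3, x i * ((ρ (n (t, x)) (s (t, x)) +
          pressure ρ (n (t, x)) (s (t, x))) * γ * v i) = H x * γ * inner ℝ x v := by
        simp only [hH, PiLp.inner_apply, Finset.mul_sum]
        exact Finset.sum_congr rfl fun i _ => by simp; ring
      rw [hsum]
      have hin : 2 * (l * γ) * inner ℝ x v ≤ l ^ 2 * γ ^ 2 * r ^ 2 + ‖v‖ ^ 2 := by
        have h2 : 0 ≤ ‖(l * γ) • x - v‖ ^ 2 := by positivity
        rw [norm_sub_sq_real, inner_smul_left, norm_smul, mul_pow, Real.norm_eq_abs, sq_abs] at h2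
        simp only [conj_trivial] at h2
        have h3 : ‖x‖ ^ 2 ≤ r ^ 2 := by gcongr
        have h4 : (l * γ) ^ 2 * ‖x‖ ^ 2 ≤ (l * γ) ^ 2 * r ^ 2 := by gcongr
        linarith
      have hpr := hρ.pressure_le_rho _ _ (sol.n_nonneg (t, x) ht.le) (sol.s_nonneg (t, x) ht.le)
      have h5 := mul_le_mul_of_nonneg_left hin (hH0 x)
      -- This is (ρ+p)(u⁰)² ≤ 2T⁰⁰, where p ≤ ρ enters.
      have h6 : H x * γ ^ 2 ≤ 2 * (ρ (n (t, x)) (s (t, x)) + H x * ‖v‖ ^ 2) := by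
        rw [hγ2]
        have := mul_nonneg (hH0 x) (sq_nonneg ‖v‖)
        simp only [hH] at this ⊢
        linarith
      have h7 : l ^ 2 * r ^ 2 * (H x * γ ^ 2) ≤
          l ^ 2 * r ^ 2 * (2 * (ρ (n (t, x)) (s (t, x)) + H x * ‖v‖ ^ 2)) := by gcongr
      have h8 : 2 * l ^ 2 * r ^ 2 * (ρ (n (t, x)) (s (t, x)) + (ρ (n (t, x)) (s (t, x)) +
          pressure ρ (n (t, x)) (s (t, x))) * ‖v‖ ^ 2 - ρ N S + ρ N S) =
          l ^ 2 * r ^ 2 * (2 * (ρ (n (t, x)) (s (t, x)) + H x * ‖v‖ ^ 2)) := by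
        simp only [hH]; ring
      rw [h8]
      linarith
  have hQM : Q ^ 2 / M ≤ K := by
    have h1 := hquad (Q / M)
    have h2 : (Q / M) ^ 2 * M = Q ^ 2 / M := by field_simp
    have h3 : 2 * (Q / M) * Q = 2 * (Q ^ 2 / M) := by ring
    linarith
  calc (1 - 3 * η ^ 2) / 2 * (1 / (E * r ^ 2 + 4 * Real.pi / 3 * ρ N S * r ^ 5)) * Q ^ 2
      = (1 - 3 * η ^ 2) * (Q ^ 2 / M) := by
        have : M = 2 * (E * r ^ 2 + 4 * Real.pi / 3 * ρ N S * r ^ 5) := by rw [hMdef]; ring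
        rw [this]
        have h0 : E * r ^ 2 + 4 * Real.pi / 3 * ρ N S * r ^ 5 ≠ 0 := by positivity
        field_simp
    _ ≤ (1 - 3 * η ^ 2) * K := by gcongr
    _ ≤ _ := hlower

end IsGlobalC1Solution

/-! ### Convergence of the weight integral and the contradiction. -/

lemma integrableOn_weight {E a R₀ : ℝ} (hE : 0 < E) (ha : 0 ≤ a) (hR₀ : 0 < R₀) :
    IntegrableOn (fun r : ℝ => 1 / (E * r ^ 2 + a * r ^ 5)) (Ioi R₀) := by
  have h1 : IntegrableOn (fun r : ℝ => E⁻¹ * r ^ (-2 : ℝ)) (Ioi R₀) :=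
    (integrableOn_Ioi_rpow_of_lt (by norm_num) hR₀).const_mul _
  refine h1.mono' ?_ ?_
  · exact (by fun_prop : Measurable fun r : ℝ =>
      1 / (E * r ^ 2 + a * r ^ 5)).aestronglyMeasurable
  · filter_upwards [ae_restrict_mem measurableSet_Ioi] with r hr
    have hr0 : 0 < r := hR₀.trans hr
    rw [Real.norm_of_nonneg (by positivity), Real.rpow_neg hr0.le, Real.rpow_two,
      ← mul_inv, one_div]
    refine inv_anti₀ (by positivity) ?_
    have : 0 ≤ a * r ^ 5 := by positivity
    linarith

end

end RelFluid

theorem mainTheorem1 (ρ : ℝ → ℝ → ℝ) (hρ : RelFluid.IsEquationOfState ρ)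
    (hA1 : RelFluid.RhoAntitoneInEntropy ρ)
    (hA2 : RelFluid.SoundSpeedMonotoneInPressure ρ)
    (R₀ nbar sbar : ℝ) (n₀ s₀ : RelFluid.Space → ℝ) (u₀ : RelFluid.Space → RelFluid.Space)
    (hdata : RelFluid.IsQuietPerturbation R₀ nbar sbar n₀ s₀ u₀)
    (E : ℝ) (hE : E = RelFluid.perturbationEnergy ρ nbar sbar n₀ s₀ u₀)
    (etabar : ℝ) (hetabar : etabar = RelFluid.soundSpeed ρ nbar sbar)
    (hD1 : etabar < 1 / 3)
    (hD2 : 0 < E)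
    (hD3 : ∀ x : RelFluid.Space, ‖x‖ ≤ R₀ → sbar ≤ s₀ x)
    (hD4 : 2 * etabar / (1 - 3 * etabar ^ 2) *
        (∫ r in Set.Ioi R₀, 1 / (E * r ^ 2 + 4 * Real.pi / 3 * ρ nbar sbar * r ^ 5))⁻¹ <
      RelFluid.radialMomentum ρ n₀ s₀ u₀) :
    ¬ ∃ (n s : RelFluid.Spacetime → ℝ) (u : RelFluid.Spacetime → RelFluid.Space),
      RelFluid.IsGlobalC1Solution ρ n₀ s₀ u₀ n s u := by
  rintro ⟨n, s, u, sol⟩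
  have hη0 : 0 < etabar := hetabar ▸ hρ.soundSpeed_pos hdata.nbar_pos hdata.sbar_pos.le
  have hk : 0 < 1 - 3 * etabar ^ 2 := by nlinarith
  have hR₀ := hdata.R₀_pos
  have hρ0 : 0 ≤ ρ nbar sbar := hρ.rho_nonneg _ _ hdata.nbar_pos.le hdata.sbar_pos.le
  have hs₀ : ∀ x, sbar ≤ s₀ x := fun x => by
    rcases le_or_gt ‖x‖ R₀ with h | h
    · exact hD3 x h
    · exact (hdata.s₀_eq x h).ge
  set g : ℝ → ℝ := fun r => 1 / (E * r ^ 2 + 4 * Real.pi / 3 * ρ nbar sbar * r ^ 5) with hg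
  have hden : ∀ r : ℝ, 0 < r → 0 < E * r ^ 2 + 4 * Real.pi / 3 * ρ nbar sbar * r ^ 5 :=
    fun r hr => by positivity
  have hgpos : ∀ r, 0 < r → 0 < g r := fun r hr => one_div_pos.2 (hden r hr)
  have hgi : MeasureTheory.IntegrableOn g (Set.Ioi R₀) :=
    RelFluid.integrableOn_weight hD2 (by positivity) hR₀
  -- Strict positivity is needed to clear the inverse in (D4), as the inverse of 0 is 0 by
  -- convention.
  have hI : 0 < ∫ r in Set.Ioi R₀, g r := by
    rw [MeasureTheory.setIntegral_pos_iff_support_of_nonneg_ae ?_ hgi]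
    · have : Function.support g ∩ Set.Ioi R₀ = Set.Ioi R₀ :=
        Set.inter_eq_right.2 fun r hr => (hgpos r (hR₀.trans hr)).ne'
      rw [this, Real.volume_Ioi]
      exact ENNReal.zero_lt_top
    · filter_upwards [MeasureTheory.ae_restrict_mem measurableSet_Ioi] with r hr
      exact (hgpos r (hR₀.trans hr)).le
  set Q : ℝ → ℝ := fun t => RelFluid.radialMomentum ρ (fun x => n (t, x)) (fun x => s (t, x))
    fun x => u (t, x) with hQ
  have hQinit : Q 0 = RelFluid.radialMomentum ρ n₀ s₀ u₀ := by
    simp only [hQ, sol.init_n, sol.init_s, sol.init_u]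
  rw [← hQinit] at hD4
  have hQ0 : 0 < Q 0 := lt_of_le_of_lt (by positivity) hD4
  have hvir := sol.hasDerivAt_radialMomentum hρ hdata
  have hmain := RelFluid.integral_le_of_riccati (Q := Q) (g := g)
    (k := (1 - 3 * etabar ^ 2) / 2) (η := etabar) (R₀ := R₀) hR₀ hη0 (by positivity)
    (continuousOn_const.div (by fun_prop) fun r hr => (hden r hr).ne')
    (fun r hr => (hgpos r hr).le) hgi (fun T => (hvir T).1)
    -- Any time horizon beyond t would serve.
    (fun t ht => (hvir (t + 1)).2 t ⟨ht, by linarith⟩)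
    (fun t ht => by
      have := sol.radialMomentum_sq_le hρ hA1 hA2 hdata (hetabar ▸ hD1) (hE ▸ hD2) hs₀ ht rfl
      rw [← hE, ← hetabar] at this
      exact this) hQ0
  -- (D4) becomes 2η̄ < Q(0)(1 - 3η̄²)∫g, the reverse of the Riccati bound.
  rw [← div_eq_mul_inv, div_div, div_lt_iff₀ (by positivity)] at hD4
  rw [le_div_iff₀ hQ0] at hmain
  linarith
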